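/- Let $\mathbf{gr}$ be the (skeleton of the) category of free groups of finite rank, with objects the free groups $\mathbb{Z}^{*n}$, $n\in\mathbb{N}$, and morphisms all group homomorphisms, and let $\mathcal{F}(\mathbf{gr})$ be the abelian category of functors from $\mathbf{gr}$ to abelian groups. For $F\in\mathcal{F}(\mathbf{gr})$ and $X_1,\dots,X_n\in\mathbf{gr}$, the cross-effect $cr_n(F)(X_1,\dots,X_n)$ is the kernel of the homomorphism $$F(X_1*\dots*X_n)\to\bigoplus_{i=1}^n F(X_1*\dots*\widehat{X_i}*\dots*X_n)$$ induced by the maps that are trivial on $X_i$ and the canonical inclusion on the other factors. The functor $F$ is polynomial of degree at most $d$ if $cr_{d+1}(F)(X_1,\dots,X_{d+1})=0$ for all $X_1,\dots,X_{d+1}$. Let $\mathcal{F}_d(\mathbf{gr})$ be the full subcategory of $\mathcal{F}(\mathbf{gr})$ of these functors; it is an abelian category and its inclusion into $\mathcal{F}(\mathbf{gr})$ is exact. **Theorem.** Let $d\in\mathbb{N}$ and let $F,G$ be objects of $\mathcal{F}_d(\mathbf{gr})$. The natural graded linear map $$\mathrm{Ext}^*_{\mathcal{F}_d(\mathbf{gr})}(F,G)\to\mathrm{Ext}^*_{\mathcal{F}(\mathbf{gr})}(F,G)$$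 induced by the inclusion functor $\mathcal{F}_d(\mathbf{gr})\to\mathcal{F}(\mathbf{gr})$ is an isomorphism, that is, for every $n\in\mathbb{N}$ the homomorphism $\mathrm{Ext}^n_{\mathcal{F}_d(\mathbf{gr})}(F,G)\to\mathrm{Ext}^n_{\mathcal{F}(\mathbf{gr})}(F,G)$ is bijective. -/

import Mathlib

open CategoryTheory CategoryTheory.Limits

universe w w' u v₁ u₁

namespace PolyFun

/-! ### Cross-effects and polynomial functors on a pointed category with finite coproducts -/

section CrossEffects

variable {C : Type u₁} [Category.{v₁} C] [HasZeroMorphisms C] [HasFiniteCoproducts C]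

/-- The canonical map `X₁ ⊔ ⋯ ⊔ Xₙ ⟶ X₁ ⊔ ⋯ ⊔ X̂ᵢ ⊔ ⋯ ⊔ Xₙ` which is zero on the summand `Xᵢ` and
the canonical inclusion on the other summands. -/
noncomputable def retraction {n : ℕ} (X : Fin n → C) (i : Fin n) :
    (∐ X) ⟶ ∐ (fun j : {j : Fin n // j ≠ i} => X j) :=
  Sigma.desc fun j =>
    if h : j = i then 0 else Sigma.ι (fun j : {j : Fin n // j ≠ i} => X j) ⟨j, h⟩

/-- The canonical inclusion `X₁ ⊔ ⋯ ⊔ X̂ᵢ ⊔ ⋯ ⊔ Xₙ ⟶ X₁ ⊔ ⋯ ⊔ Xₙ`, a section of `retraction X i`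
(used only in proofs). -/
noncomputable def inclusion {n : ℕ} (X : Fin n → C) (i : Fin n) :
    (∐ (fun j : {j : Fin n // j ≠ i} => X j)) ⟶ ∐ X :=
  Sigma.desc fun j => Sigma.ι X j.1

/-- The `n`-th cross-effect `cr_n(F)(X₁, …, Xₙ)`: the subgroup of `F(X₁ ⊔ ⋯ ⊔ Xₙ)` that is
the kernel of `F(X₁ ⊔ ⋯ ⊔ Xₙ) ⟶ ⨁ᵢ F(X₁ ⊔ ⋯ ⊔ X̂ᵢ ⊔ ⋯ ⊔ Xₙ)`. -/
noncomputable def crossEffect (F : C ⥤ AddCommGrpCat.{u}) {n : ℕ} (X : Fin n → C) :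
    AddSubgroup (F.obj (∐ X)) :=
  ⨅ i : Fin n, (F.map (retraction X i)).hom.ker

/-- A functor is polynomial of degree at most `d` if its `(d + 1)`-st cross-effect vanishes. -/
def IsPolynomialOfDegreeLE (d : ℕ) : ObjectProperty (C ⥤ AddCommGrpCat.{u}) :=
  fun F => ∀ X : Fin (d + 1) → C, crossEffect F X = ⊥

lemma mem_crossEffect (F : C ⥤ AddCommGrpCat.{u}) {n : ℕ} (X : Fin n → C) (x : F.obj (∐ X)) :
    x ∈ crossEffect F X ↔ ∀ i, F.map (retraction X i) x = 0 := by
  simp only [crossEffect, AddSubgroup.mem_iInf, AddMonoidHom.mem_ker]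

lemma isPolynomialOfDegreeLE_iff (d : ℕ) (F : C ⥤ AddCommGrpCat.{u}) :
    IsPolynomialOfDegreeLE d F ↔ ∀ (X : Fin (d + 1) → C) (x : F.obj (∐ X)),
      (∀ i, F.map (retraction X i) x = 0) → x = 0 := by
  simp only [IsPolynomialOfDegreeLE, AddSubgroup.eq_bot_iff_forall, mem_crossEffect]

/-! The subcategory of polynomial functors of degree at most `d` is closed under subobjects,
quotients and finite products, hence is an abelian category with exact inclusion functor. -/

lemma ι_retraction {n : ℕ} (X : Fin n → C) (i j : Fin n) :
    Sigma.ι X j ≫ retraction X i =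
      if h : j = i then 0 else Sigma.ι (fun j : {j : Fin n // j ≠ i} => X j) ⟨j, h⟩ := by
  simp [retraction]

lemma ι_projector {n : ℕ} (X : Fin n → C) (i j : Fin n) :
    Sigma.ι X j ≫ retraction X i ≫ inclusion X i = if j = i then 0 else Sigma.ι X j := by
  rw [← Category.assoc, ι_retraction]
  split_ifs <;> simp [inclusion]

lemma inclusion_retraction {n : ℕ} (X : Fin n → C) (i : Fin n) :
    inclusion X i ≫ retraction X i = 𝟙 _ := by
  refine Sigma.hom_ext _ _ fun j => ?_
  have h := ι_retraction X i j.1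
  rw [dif_neg j.2] at h
  simp [inclusion, h]

lemma projector_comm {n : ℕ} (X : Fin n → C) (i j : Fin n) :
    (retraction X i ≫ inclusion X i) ≫ (retraction X j ≫ inclusion X j) =
      (retraction X j ≫ inclusion X j) ≫ (retraction X i ≫ inclusion X i) := by
  refine Sigma.hom_ext _ _ fun k => ?_
  rw [← Category.assoc, ι_projector, ← Category.assoc (Sigma.ι X k), ι_projector]
  by_cases h : k = i <;> by_cases h' : k = j <;>
    simp [h, h', ι_projector, -Category.assoc] <;> simp_all [ι_projector]

lemma map_retraction_eq_zero_iff (F : C ⥤ AddCommGrpCat.{u}) {n : ℕ} (X : Fin n → C) (i : Fin n)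
    (x : F.obj (∐ X)) :
    F.map (retraction X i) x = 0 ↔ F.map (retraction X i ≫ inclusion X i) x = 0 := by
  constructor
  · intro h
    simp [h]
  · intro h
    have h₂ := congrArg (F.map (retraction X i)) h
    rw [← ConcreteCategory.comp_apply, ← F.map_comp, Category.assoc, inclusion_retraction,
      Category.comp_id] at h₂
    simpa using h₂

variable (d : ℕ)

instance : (IsPolynomialOfDegreeLE (C := C) d :
    ObjectProperty (C ⥤ AddCommGrpCat.{u})).IsClosedUnderSubobjects where
  prop_of_mono {F G} f _ hG := by
    rw [isPolynomialOfDegreeLE_iff] at hG ⊢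
    intro X x hx
    have hf : Mono (f.app (∐ X)) := inferInstance
    rw [AddCommGrpCat.mono_iff_injective] at hf
    refine hf ((hG X _ fun i => ?_).trans (map_zero _).symm)
    rw [← ConcreteCategory.comp_apply, ← f.naturality, ConcreteCategory.comp_apply, hx, map_zero]

instance : (IsPolynomialOfDegreeLE (C := C) d :
    ObjectProperty (C ⥤ AddCommGrpCat.{u})).IsClosedUnderQuotients where
  prop_of_epi {F G} f _ hF := by
    rw [isPolynomialOfDegreeLE_iff] at hF ⊢
    intro X x hx
    have hf : Epi (f.app (∐ X)) := inferInstance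
    rw [AddCommGrpCat.epi_iff_surjective] at hf
    have key : ∀ S : Finset (Fin (d + 1)), ∃ y : F.obj (∐ X), f.app _ y = x ∧
        ∀ i ∈ S, F.map (retraction X i ≫ inclusion X i) y = 0 := by
      intro S
      induction S using Finset.induction_on with
      | empty =>
        obtain ⟨y, hy⟩ := hf x
        exact ⟨y, hy, by simp⟩
      | insert a S _ ih =>
        obtain ⟨y, hy, hS⟩ := ih
        have comm : ∀ i, F.map (retraction X i ≫ inclusion X i)
            (F.map (retraction X a ≫ inclusion X a) y) =
            F.map (retraction X a ≫ inclusion X a)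
              (F.map (retraction X i ≫ inclusion X i) y) := by
          intro i
          rw [← ConcreteCategory.comp_apply, ← F.map_comp, projector_comm, F.map_comp,
            ConcreteCategory.comp_apply]
        refine ⟨y - F.map (retraction X a ≫ inclusion X a) y, ?_, ?_⟩
        · rw [map_sub, hy, ← ConcreteCategory.comp_apply, f.naturality,
            ConcreteCategory.comp_apply, hy, (map_retraction_eq_zero_iff G X a x).1 (hx a),
            sub_zero]
        · intro i hi
          rcases Finset.mem_insert.1 hi with rfl | hi
          · have idem : (retraction X i ≫ inclusion X i) ≫ (retraction X i ≫ inclusion X i) =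
                retraction X i ≫ inclusion X i := by
              rw [Category.assoc, ← Category.assoc (inclusion X i), inclusion_retraction,
                Category.id_comp]
            rw [map_sub, ← ConcreteCategory.comp_apply, ← F.map_comp, idem, sub_self]
          · rw [map_sub, comm, hS i hi, map_zero, sub_zero]
    obtain ⟨y, hy, h⟩ := key Finset.univ
    rw [← hy, hF X y fun i => (map_retraction_eq_zero_iff F X i y).2 (h i (Finset.mem_univ i)),
      map_zero]

instance : (IsPolynomialOfDegreeLE (C := C) d :
    ObjectProperty (C ⥤ AddCommGrpCat.{u})).ContainsZero where
  exists_zero := by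
    refine ⟨(Functor.const C).obj (AddCommGrpCat.of PUnit), ?_, ?_⟩
    · refine Functor.isZero _ fun X => ?_
      exact AddCommGrpCat.isZero_of_subsingleton (AddCommGrpCat.of PUnit)
    · rw [isPolynomialOfDegreeLE_iff]
      intro X x _
      exact Subsingleton.elim (α := PUnit) x _

instance : (IsPolynomialOfDegreeLE (C := C) d :
    ObjectProperty (C ⥤ AddCommGrpCat.{u})).IsClosedUnderFiniteProducts where
  isClosedUnderLimitsOfShape J _ := by
    refine ⟨fun F hF => ?_⟩
    obtain ⟨p⟩ := hF
    rw [isPolynomialOfDegreeLE_iff]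
    intro X x hx
    have hl := isLimitOfPreserves ((evaluation C AddCommGrpCat.{u}).obj (∐ X)) p.isLimit
    refine Concrete.isLimit_ext _ hl _ _ fun j => ?_
    have hj := (isPolynomialOfDegreeLE_iff d (p.diag.obj j)).1 (p.prop_diag_obj j) X
      ((p.π.app j).app _ x) fun i => by
        rw [← ConcreteCategory.comp_apply, ← (p.π.app j).naturality,
          ConcreteCategory.comp_apply]
        exact (congrArg _ (hx i)).trans (map_zero _)
    rw [map_zero]
    exact hj

end CrossEffects

/-! ### The category `gr` of finitely generated free groups -/

/-- The skeleton `gr` of the category of free groups of finite rank: there is one object for each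
`n : ℕ`, standing for the free group `ℤ ∗ ⋯ ∗ ℤ` on `n` generators; morphisms are group
homomorphisms. -/
structure Gr : Type where
  /-- the number of free generators -/
  rank : ℕ

namespace Gr

/-- The free group of rank `n` corresponding to an object of `gr`. -/
abbrev group (A : Gr) : Type := FreeGroup (Fin A.rank)

instance : Category.{0} Gr where
  Hom A B := A.group →* B.group
  id A := MonoidHom.id A.group
  comp f g := MonoidHom.comp g f

/-- The group homomorphism underlying a morphism of `gr`. -/
abbrev Hom.toMonoidHom {A B : Gr} (f : A ⟶ B) : A.group →* B.group := f

instance : HasZeroMorphisms Gr where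
  zero A B := ⟨(1 : A.group →* B.group)⟩
  comp_zero {_ B} f E := (MonoidHom.one_comp f : (1 : B.group →* E.group).comp f = 1)
  zero_comp A {B _} f := (MonoidHom.comp_one f : f.comp (1 : A.group →* B.group) = 1)

/-- The free product of a finite family of free groups of finite rank: the free group on the
disjoint union of the generators. -/
abbrev freeProd {n : ℕ} (X : Fin n → Gr) : Gr := ⟨∑ i, (X i).rank⟩

/-- The inclusion of a factor in a free product. -/
def freeProdIncl {n : ℕ} (X : Fin n → Gr) (i : Fin n) : (X i).group →* (freeProd X).group :=
  FreeGroup.map fun k => finSigmaFinEquiv ⟨i, k⟩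

/-- The homomorphism out of a free product given by a family of homomorphisms on the factors. -/
def freeProdDesc {n : ℕ} (X : Fin n → Gr) {B : Type} [Group B] (f : ∀ i, (X i).group →* B) :
    (freeProd X).group →* B :=
  FreeGroup.lift fun k => f (finSigmaFinEquiv.symm k).1 (FreeGroup.of (finSigmaFinEquiv.symm k).2)

lemma freeProdDesc_comp_incl {n : ℕ} (X : Fin n → Gr) {B : Type} [Group B]
    (f : ∀ i, (X i).group →* B) (i : Fin n) :
    (freeProdDesc X f).comp (freeProdIncl X i) = f i := by
  refine FreeGroup.ext_hom _ _ fun k => ?_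
  simp only [MonoidHom.comp_apply, freeProdIncl, FreeGroup.map.of, freeProdDesc,
    FreeGroup.lift_apply_of]
  rw [Equiv.symm_apply_apply]

lemma eq_freeProdDesc {n : ℕ} (X : Fin n → Gr) {B : Type} [Group B]
    (f : ∀ i, (X i).group →* B) (m : (freeProd X).group →* B)
    (hm : ∀ i, m.comp (freeProdIncl X i) = f i) : m = freeProdDesc X f := by
  refine FreeGroup.ext_hom _ _ fun k => ?_
  obtain ⟨⟨i, k⟩, rfl⟩ := finSigmaFinEquiv.surjective k
  have h := DFunLike.congr_fun ((hm i).trans (freeProdDesc_comp_incl X f i).symm) (FreeGroup.of k)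
  simpa only [MonoidHom.comp_apply, freeProdIncl, FreeGroup.map.of] using h

/-- The free product with its inclusions, as a cofan in `gr`. -/
def cofan {n : ℕ} (X : Fin n → Gr) : Cofan X :=
  Cofan.mk (freeProd X) (freeProdIncl X)

/-- The free product is the coproduct in `gr`. -/
def isColimitCofan {n : ℕ} (X : Fin n → Gr) : IsColimit (cofan X) :=
  Cofan.IsColimit.mk _
    (fun s => freeProdDesc X fun i => Hom.toMonoidHom (s.inj i))
    (fun _ i => freeProdDesc_comp_incl X _ i)
    (fun _ m hm => eq_freeProdDesc X _ m hm)

instance : HasFiniteCoproducts Gr where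
  out n := ⟨fun K => by
    have : HasColimit (Discrete.functor (K.obj ∘ Discrete.mk)) :=
      ⟨⟨⟨cofan _, isColimitCofan _⟩⟩⟩
    exact hasColimit_of_iso (Discrete.natIsoFunctor : K ≅ _)⟩

end Gr

/-- The category `F(gr)` of functors from `gr` to abelian groups. -/
abbrev FunGr : Type (u + 1) := Gr ⥤ AddCommGrpCat.{u}

/-- The full subcategory `F_d(gr)` of `F(gr)` of polynomial functors of degree at most `d`. -/
abbrev PolyGr (d : ℕ) : Type (u + 1) :=
  (IsPolynomialOfDegreeLE d : ObjectProperty FunGr.{u}).FullSubcategory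

/-- The inclusion functor `F_d(gr) ⥤ F(gr)`. -/
abbrev polyInclusion (d : ℕ) : PolyGr.{u} d ⥤ FunGr.{u} :=
  (IsPolynomialOfDegreeLE d : ObjectProperty FunGr.{u}).ι

instance (d : ℕ) : PreservesFiniteLimits (polyInclusion.{u} d) := by
  have : ∀ ⦃X Y : PolyGr.{u} d⦄ (f : X ⟶ Y), PreservesLimit (parallelPair f 0)
    (polyInclusion.{u} d) := (IsPolynomialOfDegreeLE d).preservesKernels_ι
  exact Functor.preservesFiniteLimits_of_preservesKernels (polyInclusion.{u} d)

instance (d : ℕ) : PreservesFiniteColimits (polyInclusion.{u} d) := by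
  have : ∀ ⦃X Y : PolyGr.{u} d⦄ (f : X ⟶ Y), PreservesColimit (parallelPair f 0)
    (polyInclusion.{u} d) := (IsPolynomialOfDegreeLE d).preservesCokernels_ι
  exact Functor.preservesFiniteColimits_of_preservesCokernels (polyInclusion.{u} d)

end PolyFun

universe u₂ v₂ t

namespace PolyFun

/-! ### Vanishing of `Ext`-groups -/

section ExtVanishing

open Abelian

/-! Write Ext for extensions in F(gr) and I for the augmentation ideal of the group ring. The
inclusion of F_d(gr) is exact and full, so dimension shifting gives the theorem once every F in
F_d(gr) is a quotient of some Q in F_d(gr) with Ext^i(Q, G) = 0 for all i > 0 and all G in F_d(gr)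
(`mapExt_bijective_of_acyclic_cover`).

Such a Q is `polyCover`: cover F by a sum P of projective functors ℤ[Xⁿ], and divide each summand by
the (d+1)-st power of the augmentation ideal of Xⁿ. Let K be the sum of these powers. Alternating
sums over commuting endomorphisms push elements down the filtration by powers, so P/K has degree at
most d (`isPolynomialOfDegreeLE_polyCover`). Moreover Ext^*(K, G) = 0 for G of degree at most d
(`orthogonal_coverKernel`): this makes P/K acyclic, and in degree 0 it makes the cover P → F factor
through P/K.

The heart is `orthogonal_augMul`: multiplication by I raises the order of orthogonality to
polynomial functors by one. The functor I ⊗ - is left adjoint to the exact difference functor Δ,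
which lowers degrees (`redIndAdjunction`), so I ⊗ K gains one order over K. Now I · K is only a
quotient of I ⊗ K. Because the groups are free, I is a free right module over the group ring, and
the kernel of I ⊗ K → I · K is I · R, where R is the kernel of ℤ[-] ⊗ K → K. Since R is as
orthogonal as K, an induction on the degree of Ext finishes the argument. -/

lemma exists_shortExact_injective (C : Type u₁) [Category.{v₁} C] [Abelian C]
    [EnoughInjectives C] (G : C) :
    ∃ (S : ShortComplex C) (_ : S.ShortExact), S.X₁ = G ∧ Injective S.X₂ :=
  ⟨ShortComplex.mk (Injective.ι G) (cokernel.π (Injective.ι G)) (cokernel.condition _),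
    { exact := ShortComplex.exact_cokernel _ }, rfl,
    inferInstanceAs (Injective (Injective.under G))⟩

variable {C : Type u₁} [Category.{v₁} C] [Abelian C] [HasExt.{w} C]

lemma subsingleton_ext_of_forall {X Y : C} {n : ℕ} (h : ∀ x : Ext X Y n, x = 0) :
    Subsingleton (Ext X Y n) :=
  ⟨fun x y => (h x).trans (h y).symm⟩

lemma subsingleton_ext_zero_iff {X Y : C} :
    Subsingleton (Ext X Y 0) ↔ ∀ f : X ⟶ Y, f = 0 := by
  rw [Ext.homEquiv₀.subsingleton_congr]
  exact ⟨fun _ f => Subsingleton.elim _ _, fun h => ⟨fun f g => (h f).trans (h g).symm⟩⟩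

variable {S : ShortComplex C} (hS : S.ShortExact) (G : C)

include hS in
lemma subsingleton_ext_zero_X₃ (h₂ : Subsingleton (Ext S.X₂ G 0)) :
    Subsingleton (Ext S.X₃ G 0) := by
  rw [subsingleton_ext_zero_iff] at h₂ ⊢
  intro f
  have := hS.epi_g
  exact (cancel_epi S.g).1 ((h₂ _).trans comp_zero.symm)

include hS in
lemma subsingleton_ext_succ_X₃ {n : ℕ} (h₁ : Subsingleton (Ext S.X₁ G n))
    (h₂ : Subsingleton (Ext S.X₂ G (n + 1))) : Subsingleton (Ext S.X₃ G (n + 1)) := by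
  refine subsingleton_ext_of_forall fun x => ?_
  obtain ⟨y, rfl⟩ := Ext.contravariant_sequence_exact₃ hS G x (Subsingleton.elim _ _)
    (add_comm 1 n)
  rw [Subsingleton.elim y 0, Ext.comp_zero]

include hS in
lemma subsingleton_ext_X₂ {n : ℕ} (h₁ : Subsingleton (Ext S.X₁ G n))
    (h₃ : Subsingleton (Ext S.X₃ G n)) : Subsingleton (Ext S.X₂ G n) := by
  refine subsingleton_ext_of_forall fun x => ?_
  obtain ⟨y, rfl⟩ := Ext.contravariant_sequence_exact₂ hS G x (Subsingleton.elim _ _)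
  rw [Subsingleton.elim y 0, Ext.comp_zero]

include hS in
lemma subsingleton_ext_X₁ {n : ℕ} (h₂ : Subsingleton (Ext S.X₂ G n))
    (h₃ : Subsingleton (Ext S.X₃ G (n + 1))) : Subsingleton (Ext S.X₁ G n) := by
  refine subsingleton_ext_of_forall fun x => ?_
  obtain ⟨y, rfl⟩ := Ext.contravariant_sequence_exact₁ hS G x (add_comm 1 n)
    (Subsingleton.elim _ _)
  rw [Subsingleton.elim y 0, Ext.comp_zero]

/-- Extension classes of degree one by the kernel of an injective envelope vanish as soon as
morphisms to the quotient lift. -/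
lemma subsingleton_ext_one_of_lift {S : ShortComplex C} (hS : S.ShortExact) [Injective S.X₂]
    {X : C} (h : ∀ f : X ⟶ S.X₃, ∃ g : X ⟶ S.X₂, g ≫ S.g = f) :
    Subsingleton (Ext X S.X₁ 1) := by
  refine subsingleton_ext_of_forall fun x => ?_
  obtain ⟨y, rfl⟩ := Ext.covariant_sequence_exact₁ X hS x (Ext.eq_zero_of_injective _) rfl
  obtain ⟨f, rfl⟩ := (Ext.mk₀_bijective _ _).surjective y
  obtain ⟨g, rfl⟩ := h f
  rw [← Ext.mk₀_comp_mk₀, Ext.comp_assoc_of_second_deg_zero, hS.comp_extClass, Ext.comp_zero]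

lemma exists_lift_of_subsingleton_ext_one {S : ShortComplex C} (hS : S.ShortExact)
    {X : C} (h : Subsingleton (Ext X S.X₁ 1)) (f : X ⟶ S.X₃) : ∃ g : X ⟶ S.X₂, g ≫ S.g = f := by
  obtain ⟨y, hy⟩ := Ext.covariant_sequence_exact₃ X hS (Ext.mk₀ f) (zero_add 1)
    (Subsingleton.elim _ _)
  obtain ⟨g, rfl⟩ := (Ext.mk₀_bijective _ _).surjective y
  exact ⟨g, (Ext.mk₀_bijective _ _).injective (by rw [← hy, Ext.mk₀_comp_mk₀])⟩

lemma subsingleton_ext_succ_of_shift {S : ShortComplex C} (hS : S.ShortExact) [Injective S.X₂]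
    {X : C} {n : ℕ} (h : Subsingleton (Ext X S.X₃ n)) : Subsingleton (Ext X S.X₁ (n + 1)) := by
  refine subsingleton_ext_of_forall fun x => ?_
  obtain ⟨y, rfl⟩ := Ext.covariant_sequence_exact₁ X hS x (Ext.eq_zero_of_injective _) rfl
  rw [Subsingleton.elim y 0, Ext.zero_comp]

lemma subsingleton_ext_shift {S : ShortComplex C} (hS : S.ShortExact) [Injective S.X₂]
    {X : C} {n : ℕ} (h : Subsingleton (Ext X S.X₁ (n + 2))) :
    Subsingleton (Ext X S.X₃ (n + 1)) := by
  refine subsingleton_ext_of_forall fun x => ?_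
  obtain ⟨y, rfl⟩ := Ext.covariant_sequence_exact₃ X hS x rfl (Subsingleton.elim _ _)
  rw [Ext.eq_zero_of_injective y, Ext.zero_comp]

/-- Vanishing of `Ext` into a fixed object, in a fixed degree, is inherited by coproducts. -/
lemma subsingleton_ext_sigma [EnoughInjectives C] {J : Type t} (K : J → C) [HasCoproduct K]
    (n : ℕ) (G : C) (h : ∀ j, Subsingleton (Ext (K j) G n)) : Subsingleton (Ext (∐ K) G n) := by
  induction n generalizing G with
  | zero =>
    simp only [subsingleton_ext_zero_iff] at h ⊢
    exact fun f => Sigma.hom_ext _ _ fun j => (h j _).trans comp_zero.symm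
  | succ n ih =>
    obtain ⟨S, hS, rfl, _⟩ := exists_shortExact_injective C G
    cases n with
    | zero =>
      -- Degree 1 is a lifting problem, and lifts glue over a coproduct. Shifting in the second
      -- variable avoids any exactness of coproducts.
      refine subsingleton_ext_one_of_lift hS fun f => ?_
      choose g hg using fun j =>
        exists_lift_of_subsingleton_ext_one hS (h j) (Sigma.ι K j ≫ f)
      exact ⟨Sigma.desc g, Sigma.hom_ext _ _ fun j => by simp [hg]⟩
    | succ n =>
      exact subsingleton_ext_succ_of_shift hS (ih _ fun j => subsingleton_ext_shift hS (h j))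

/-- Transfer of the vanishing of `Ext` along an adjunction between exact functors. -/
lemma subsingleton_ext_of_adjunction [EnoughInjectives C] {D : Type u₂} [Category.{v₂} D]
    [Abelian D] [HasExt.{w'} D] {L : D ⥤ C} {R : C ⥤ D} (adj : L ⊣ R)
    [L.PreservesMonomorphisms] [R.PreservesEpimorphisms] [R.PreservesZeroMorphisms]
    (n : ℕ) (A : D) (G : C) (h : Subsingleton (Ext A (R.obj G) n)) :
    Subsingleton (Ext (L.obj A) G n) := by
  have := adj.rightAdjoint_preservesLimits
  induction n generalizing G with
  | zero =>
    rw [subsingleton_ext_zero_iff] at h ⊢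
    intro f
    exact (adj.homEquiv A G).injective ((h _).trans (h _).symm)
  | succ n ih =>
    obtain ⟨S, hS, rfl, _⟩ := exists_shortExact_injective C G
    have hR : (S.map R).ShortExact :=
      { exact := by
          have := hS.mono_f
          exact hS.exact.map_of_mono_of_preservesKernel R inferInstance inferInstance
        mono_f := by
          have := hS.mono_f
          exact inferInstanceAs (Mono (R.map S.f))
        epi_g := by
          have := hS.epi_g
          exact inferInstanceAs (Epi (R.map S.g)) }
    -- As L preserves monomorphisms, R preserves injectives; the same embedding of G therefore
    -- shifts dimensions on both sides of the adjunction.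
    have : Injective (S.map R).X₂ := Injective.injective_of_adjoint adj S.X₂
    cases n with
    | zero =>
      refine subsingleton_ext_one_of_lift hS fun f => ?_
      obtain ⟨g, hg⟩ := exists_lift_of_subsingleton_ext_one hR h (adj.homEquiv _ _ f)
      refine ⟨(adj.homEquiv _ _).symm g, (adj.homEquiv _ _).injective ?_⟩
      exact (adj.homEquiv_naturality_right _ _).trans
        ((congrArg (· ≫ R.map S.g) (Equiv.apply_symm_apply _ g)).trans hg)
    | succ n =>
      exact subsingleton_ext_succ_of_shift hS (ih _ (subsingleton_ext_shift hR h))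

end ExtVanishing

/-! ### Comparison of `Ext` along an exact full embedding -/

section ExtComparison

open Abelian Functor

variable {C : Type u₁} [Category.{v₁} C] [Abelian C]
  {D : Type u₂} [Category.{v₂} D] [Abelian D] [HasExt.{w'} D]
  (F : C ⥤ D) [F.Additive] [PreservesFiniteLimits F] [PreservesFiniteColimits F]

attribute [local simp] Ext.mapExactFunctor_comp Ext.mapExactFunctor_mk₀ Ext.mapExactFunctor_extClass

/-- An object that is acyclic in the target of an exact embedding is projective in the source. -/
lemma projective_of_subsingleton_ext_map [F.Full] [F.Faithful] {Q : C}
    (h : ∀ Y : C, Subsingleton (Ext (F.obj Q) (F.obj Y) 1)) : Projective Q where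
  factors {E X} f e _ := by
    have hS : (ShortComplex.mk _ _ (kernel.condition e)).ShortExact :=
      { exact := ShortComplex.exact_kernel e }
    obtain ⟨g, hg⟩ := exists_lift_of_subsingleton_ext_one (hS.map_of_exact F) (h _) (F.map f)
    obtain ⟨g, rfl⟩ := F.map_surjective g
    exact ⟨g, F.map_injective ((F.map_comp _ _).trans hg)⟩

/-- An exact full embedding induces isomorphisms on `Ext` if the source has enough objects that
are acyclic in the target. -/
lemma mapExt_bijective_of_acyclic_cover [HasExt.{w} C] [F.Full] [F.Faithful]
    (H : ∀ X : C, ∃ (Q : C) (p : Q ⟶ X), Epi p ∧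
      ∀ (Y : C) (n : ℕ), Subsingleton (Ext (F.obj Q) (F.obj Y) (n + 1)))
    (X Y : C) (n : ℕ) : Function.Bijective (F.mapExtAddHom X Y n) := by
  induction n generalizing X with
  | zero => simpa [Ext.mapExactFunctor₀] using ⟨Faithful.map_injective, Full.map_surjective⟩
  | succ n hn =>
    obtain ⟨Q, p, _, hQ⟩ := H X
    have : Projective Q := projective_of_subsingleton_ext_map F fun Y => hQ Y 0
    let S := ShortComplex.mk _ _ (kernel.condition p)
    have hS : S.ShortExact := { exact := ShortComplex.exact_kernel p }
    have h₁ : Subsingleton (Ext S.X₂ Y (n + 1)) := Ext.subsingleton_of_projective Q Y n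
    have h₂ : Subsingleton (Ext (S.map F).X₂ (F.obj Y) (n + 1)) := hQ Y n
    -- In both rows Ext^(n+1) of the middle term vanishes, so Ext^(n+1) of X is the cokernel of
    -- Ext^n(Q) → Ext^n(ker p). Degree n for Q and for the kernel then suffices, whence the
    -- induction over all X.
    exact AddMonoidHom.bijective_of_surjective_of_bijective_of_right_exact _ _ _ _
      (F.mapExtAddHom S.X₂ Y n) (F.mapExtAddHom S.X₁ Y n) (F.mapExtAddHom S.X₃ Y (n + 1))
      (by cat_disch) (by cat_disch)
      ((ShortComplex.ab_exact_iff_function_exact _).1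
        (Ext.contravariant_sequence_exact₁' hS Y n (n + 1) (add_comm 1 n)))
      ((ShortComplex.ab_exact_iff_function_exact _).1
        (Ext.contravariant_sequence_exact₁' (hS.map_of_exact F) (F.obj Y) n (n + 1)
          (add_comm 1 n)))
      (hn _).surjective (hn _)
      (fun x₃ ↦ Ext.contravariant_sequence_exact₃ hS _ x₃ (by subsingleton) (add_comm 1 n))
      (fun y₃ ↦ Ext.contravariant_sequence_exact₃ (hS.map_of_exact F) _ y₃ (by subsingleton)
        (add_comm 1 n))

end ExtComparison

/-! ### Injectives and short exact sequences in `FunGr` -/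

instance : EnoughInjectives FunGr.{u} := by
  -- Functors are sheaves for the trivial topology, and these form a Grothendieck abelian category.
  let e : Sheaf (⊥ : GrothendieckTopology Grᵒᵖ) AddCommGrpCat.{u} ≌ FunGr.{u} :=
    (sheafBotEquivalence _).trans (opOpEquivalence Gr).congrLeft
  have : EssentiallySmall.{u} Grᵒᵖ := essentiallySmall_of_small_of_locallySmall _
  have := Sheaf.isGrothendieckAbelian_of_essentiallySmall (⊥ : GrothendieckTopology Grᵒᵖ)
    AddCommGrpCat.{u}
  exact EnoughInjectives.of_equivalence e.inverse

lemma shortExact_of_pointwise {S : ShortComplex FunGr.{u}}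
    (hf : ∀ X, Function.Injective (S.f.app X)) (hg : ∀ X, Function.Surjective (S.g.app X))
    (hfg : ∀ X x, S.g.app X x = 0 → ∃ y, S.f.app X y = x) : S.ShortExact where
  mono_f := by
    rw [NatTrans.mono_iff_mono_app]
    exact fun X => (AddCommGrpCat.mono_iff_injective _).2 (hf X)
  epi_g := by
    rw [NatTrans.epi_iff_epi_app]
    exact fun X => (AddCommGrpCat.epi_iff_surjective _).2 (hg X)
  exact := by
    rw [ShortComplex.exact_iff_isZero_homology]
    refine Functor.isZero _ fun X => ?_
    have h : (S.map ((evaluation _ _).obj X)).Exact :=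
      (ShortComplex.ab_exact_iff _).2 (hfg X)
    rw [ShortComplex.exact_iff_isZero_homology] at h
    exact h.of_iso (S.mapHomologyIso ((evaluation _ _).obj X)).symm

/-! ### Subfunctors of functors on `gr` -/

/-- A subfunctor of a functor from `gr` to abelian groups. -/
structure SubFun (M : FunGr.{u}) where
  /-- the values of the subfunctor -/
  carrier : ∀ X, AddSubgroup (M.obj X)
  map_mem : ∀ {X Y : Gr} (f : X ⟶ Y) {m : M.obj X}, m ∈ carrier X → M.map f m ∈ carrier Y

namespace SubFun

variable {M N : FunGr.{u}}

/-- The functor underlying a subfunctor. -/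
def toFunctor (K : SubFun M) : FunGr.{u} where
  obj X := AddCommGrpCat.of (K.carrier X)
  map {X Y} f := AddCommGrpCat.ofHom
    (((M.map f).hom.comp (K.carrier X).subtype).codRestrict (K.carrier Y)
      fun m => K.map_mem f m.2)
  map_id X := by
    ext m
    exact ConcreteCategory.congr_hom (M.map_id X) m.1
  map_comp f g := by
    ext m
    exact ConcreteCategory.congr_hom (M.map_comp f g) m.1

/-- The inclusion of a subfunctor. -/
def ι (K : SubFun M) : K.toFunctor ⟶ M where
  app X := AddCommGrpCat.ofHom (K.carrier X).subtype

/-- The value of a subfunctor, as a subtype. -/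
def of (K : SubFun M) {X : Gr} (m : M.obj X) (hm : m ∈ K.carrier X) : K.toFunctor.obj X :=
  (⟨m, hm⟩ : K.carrier X)

@[simp] lemma ι_of (K : SubFun M) {X : Gr} (m : M.obj X) (hm : m ∈ K.carrier X) :
    K.ι.app X (K.of m hm) = m := rfl

lemma ι_mem (K : SubFun M) {X : Gr} (m : K.toFunctor.obj X) : K.ι.app X m ∈ K.carrier X :=
  Subtype.property (p := (· ∈ K.carrier X)) m

lemma ι_injective (K : SubFun M) (X : Gr) : Function.Injective (K.ι.app X) :=
  Subtype.val_injective (p := (· ∈ K.carrier X))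

lemma ι_map (K : SubFun M) {X Y : Gr} (f : X ⟶ Y) (m : K.toFunctor.obj X) :
    K.ι.app Y (K.toFunctor.map f m) = M.map f (K.ι.app X m) := rfl

instance (K : SubFun M) : Mono K.ι := by
  rw [NatTrans.mono_iff_mono_app]
  exact fun X => (AddCommGrpCat.mono_iff_injective _).2 (K.ι_injective X)

/-- A natural transformation with values in a subfunctor factors through it. -/
def lift (K : SubFun M) (φ : N ⟶ M) (h : ∀ X n, φ.app X n ∈ K.carrier X) : N ⟶ K.toFunctor where
  app X := AddCommGrpCat.ofHom ((φ.app X).hom.codRestrict (K.carrier X) (h X))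
  naturality X Y f := by
    ext n
    exact K.ι_injective Y (ConcreteCategory.congr_hom (φ.naturality f) n)

/-- The kernel of a natural transformation. -/
def ker (φ : M ⟶ N) : SubFun M where
  carrier X := (φ.app X).hom.ker
  map_mem {X Y} f m hm := by
    rw [AddMonoidHom.mem_ker] at hm ⊢
    have := ConcreteCategory.congr_hom (φ.naturality f) m
    simp only [ConcreteCategory.comp_apply] at this
    exact this.trans ((congrArg (N.map f) hm).trans (map_zero _))

lemma mem_ker {φ : M ⟶ N} {X : Gr} {m : M.obj X} : m ∈ (ker φ).carrier X ↔ φ.app X m = 0 :=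
  Iff.rfl

/-- The whole functor, as a subfunctor. -/
def top (M : FunGr.{u}) : SubFun M where
  carrier _ := ⊤
  map_mem _ _ _ := trivial

/-- The zero subfunctor. -/
def bot (M : FunGr.{u}) : SubFun M where
  carrier _ := ⊥
  map_mem f m hm := by
    rw [AddSubgroup.mem_bot] at hm ⊢
    rw [hm, map_zero]

end SubFun

/-! ### Translations on functions with values in an abelian group -/

section Translation

variable {G A B : Type*} [Group G] [AddCommGroup A] [AddCommGroup B]

/-- The left translation action of a group `G` on the finitely supported functions on `G`. -/
noncomputable def translate (g : G) : (G →₀ A) →+ (G →₀ A) :=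
  Finsupp.mapDomain.addMonoidHom (g * ·)

@[simp] lemma translate_single (g h : G) (a : A) :
    translate g (Finsupp.single h a) = Finsupp.single (g * h) a :=
  Finsupp.mapDomain_single

@[simp] lemma translate_one (x : G →₀ A) : translate 1 x = x := by
  simp only [translate, Finsupp.mapDomain.addMonoidHom_apply, one_mul]
  exact Finsupp.mapDomain_id

lemma translate_mul (g h : G) (x : G →₀ A) : translate (g * h) x = translate g (translate h x) := by
  simp only [translate, Finsupp.mapDomain.addMonoidHom_apply, ← Finsupp.mapDomain_comp]
  congr 1
  funext k
  exact mul_assoc g h k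

/-- The product of the augmentation ideal with a subgroup of the finitely supported functions on
`G`. -/
noncomputable def augMul (H : AddSubgroup (G →₀ A)) : AddSubgroup (G →₀ A) :=
  AddSubgroup.closure {x | ∃ g : G, ∃ y ∈ H, translate g y - y = x}

lemma translate_sub_mem_augMul {H : AddSubgroup (G →₀ A)} (g : G) {y : G →₀ A} (hy : y ∈ H) :
    translate g y - y ∈ augMul H :=
  AddSubgroup.subset_closure ⟨g, y, hy, rfl⟩

lemma augMul_mono {H K : AddSubgroup (G →₀ A)} (h : H ≤ K) : augMul H ≤ augMul K :=
  AddSubgroup.closure_mono fun _ ⟨g, y, hy, e⟩ => ⟨g, y, h hy, e⟩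

lemma augMul_le {H K : AddSubgroup (G →₀ A)} (h : ∀ g, ∀ y ∈ H, translate g y - y ∈ K) :
    augMul H ≤ K :=
  (AddSubgroup.closure_le _).2 fun _ ⟨g, y, hy, e⟩ => e ▸ h g y hy

lemma augMul_le_self {H : AddSubgroup (G →₀ A)} (hH : ∀ g, ∀ y ∈ H, translate g y ∈ H) :
    augMul H ≤ H :=
  augMul_le fun g y hy => H.sub_mem (hH g y hy) hy

lemma translate_mem_augMul {H : AddSubgroup (G →₀ A)} (hH : ∀ g, ∀ y ∈ H, translate g y ∈ H)
    (g : G) {x : G →₀ A} (hx : x ∈ augMul H) : translate g x ∈ augMul H := by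
  have : translate g x = (translate g x - x) + x := by abel
  rw [this]
  exact add_mem (translate_sub_mem_augMul g (augMul_le_self hH hx)) hx

variable {n : ℕ}

/-- Over a free group, elements of `I · H` are combinations of the elements `x - 1`, for `x` a
generator, with coefficients in `H`. -/
lemma exists_eq_sum_of_mem_augMul {H : AddSubgroup (FreeGroup (Fin n) →₀ A)}
    (hH : ∀ g, ∀ y ∈ H, translate g y ∈ H) {x : FreeGroup (Fin n) →₀ A} (hx : x ∈ augMul H) :
    ∃ m : Fin n → FreeGroup (Fin n) →₀ A, (∀ k, m k ∈ H) ∧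
      x = ∑ k, (translate (FreeGroup.of k) (m k) - m k) := by
  let T : AddSubgroup (FreeGroup (Fin n) →₀ A) :=
    { carrier := {x | ∃ m : Fin n → FreeGroup (Fin n) →₀ A, (∀ k, m k ∈ H) ∧
        x = ∑ k, (translate (FreeGroup.of k) (m k) - m k)}
      zero_mem' := ⟨0, fun _ => H.zero_mem, by simp⟩
      add_mem' := by
        rintro _ _ ⟨m, hm, rfl⟩ ⟨m', hm', rfl⟩
        refine ⟨m + m', fun k => H.add_mem (hm k) (hm' k), ?_⟩
        rw [← Finset.sum_add_distrib]
        refine Finset.sum_congr rfl fun k _ => ?_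
        simp only [Pi.add_apply, map_add]
        abel
      neg_mem' := by
        rintro _ ⟨m, hm, rfl⟩
        refine ⟨-m, fun k => H.neg_mem (hm k), ?_⟩
        rw [← Finset.sum_neg_distrib]
        refine Finset.sum_congr rfl fun k _ => ?_
        simp only [Pi.neg_apply, map_neg]
        abel }
  -- The g with (g - 1)H ⊆ T form a subgroup, since gh - 1 = (g - 1)h + (h - 1) and H is stable; so
  -- generators suffice.
  refine augMul_le (K := T) (fun g => ?_) hx
  induction g using FreeGroup.induction_on with
  | C1 => exact fun y _ => by simp [T.zero_mem]
  | of k =>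
    intro y hy
    refine ⟨Pi.single k y, fun j => ?_, ?_⟩
    · rcases eq_or_ne j k with rfl | h
      · simpa using hy
      · simp [h, H.zero_mem]
    · rw [Finset.sum_eq_single k (fun j _ hj => by simp [hj]) (by simp)]
      simp
  | inv_of k ih =>
    intro y hy
    have h := ih _ (hH (FreeGroup.of k)⁻¹ y hy)
    rw [← translate_mul, mul_inv_cancel, translate_one] at h
    rw [← neg_sub]
    exact T.neg_mem h
  | mul g h ihg ihh =>
    intro y hy
    have := T.add_mem (ihg _ (hH h y hy)) (ihh y hy)
    rw [← translate_mul, sub_add_sub_cancel] at this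
    exact this

/-- The action of the free group on pairs that records the Fox derivative with respect to the
generator `k`. -/
noncomputable def foxAction (A : Type*) [AddCommGroup A] (k : Fin n) :
    FreeGroup (Fin n) →* Equiv.Perm ((A →+ (FreeGroup (Fin n) →₀ A)) × FreeGroup (Fin n)) :=
  -- The rule D(gh) = D(g)h + D(h) does not define a homomorphism g ↦ D(g). Letting generators act
  -- by permutations of pairs makes the universal property apply; g sends (0, 1) to (D(g), g), with
  -- D(g) regarded as the map a ↦ D(g) ⊗ a.
  FreeGroup.lift fun j =>
    { toFun := fun p =>
        (p.1 + if j = k then Finsupp.singleAddHom p.2 else 0, FreeGroup.of j * p.2)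
      invFun := fun p => (p.1 - if j = k then Finsupp.singleAddHom ((FreeGroup.of j)⁻¹ * p.2) else 0,
        (FreeGroup.of j)⁻¹ * p.2)
      left_inv := fun p => by simp
      right_inv := fun p => by simp }

lemma foxAction_of (k j : Fin n) (p : (A →+ (FreeGroup (Fin n) →₀ A)) × FreeGroup (Fin n)) :
    foxAction A k (FreeGroup.of j) p =
      (p.1 + if j = k then Finsupp.singleAddHom p.2 else 0, FreeGroup.of j * p.2) := by
  simp [foxAction]

lemma foxAction_snd (k : Fin n) (g : FreeGroup (Fin n))
    (p : (A →+ (FreeGroup (Fin n) →₀ A)) × FreeGroup (Fin n)) :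
    (foxAction A k g p).2 = g * p.2 := by
  induction g using FreeGroup.induction_on generalizing p with
  | C1 => simp
  | of j => rw [foxAction_of]
  | inv_of j ih =>
    have := ih (foxAction A k (FreeGroup.of j)⁻¹ p)
    rw [← Equiv.Perm.mul_apply, ← map_mul, mul_inv_cancel, map_one, Equiv.Perm.one_apply] at this
    rw [this, inv_mul_cancel_left]
  | mul g h ihg ihh => rw [map_mul, Equiv.Perm.mul_apply, ihg, ihh, mul_assoc]

/-- The Fox derivative with respect to the generator `k`. -/
noncomputable def foxDeriv (A : Type*) [AddCommGroup A] (k : Fin n) :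
    (FreeGroup (Fin n) →₀ A) →+ (FreeGroup (Fin n) →₀ A) :=
  Finsupp.liftAddHom fun g => (foxAction A k g (0, 1)).1

/-- Consequently the k-th derivative of ∑ (xⱼ - 1)mⱼ is exactly mₖ, which gives uniqueness of the
coefficients. -/
lemma foxDeriv_translate_of (k j : Fin n) (x : FreeGroup (Fin n) →₀ A) :
    foxDeriv A k (translate (FreeGroup.of j) x) = foxDeriv A k x + if j = k then x else 0 := by
  induction x using Finsupp.induction_linear with
  | zero => simp
  | add x y hx hy =>
    simp only [map_add, hx, hy]
    split_ifs <;> abel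
  | single g a =>
    simp only [foxDeriv, translate_single, Finsupp.liftAddHom_apply_single, map_mul,
      Equiv.Perm.mul_apply, foxAction_of, AddMonoidHom.add_apply, foxAction_snd, mul_one]
    split_ifs <;> simp

/-- The augmentation ideal of the group ring of a free group is free on the elements `x - 1`, for
`x` a generator. -/
lemma eq_zero_of_sum_translate_sub_eq_zero (m : Fin n → FreeGroup (Fin n) →₀ A)
    (h : ∑ k, (translate (FreeGroup.of k) (m k) - m k) = 0) (k : Fin n) : m k = 0 := by
  have := congrArg (foxDeriv A k) h
  simpa [foxDeriv_translate_of, Finset.sum_add_distrib] using this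

end Translation

/-! ### Induced functors -/

section Induced

variable {M N : FunGr.{u}}

/-- The functor `X ↦ ℤ[X] ⊗ M(X)`. -/
noncomputable def ind (M : FunGr.{u}) : FunGr.{u} where
  obj X := AddCommGrpCat.of (X.group →₀ M.obj X)
  map {X Y} f := AddCommGrpCat.ofHom
    ((Finsupp.mapDomain.addMonoidHom (Gr.Hom.toMonoidHom f)).comp
      (Finsupp.mapRange.addMonoidHom (M.map f).hom))
  map_id X := by
    ext : 1
    refine Finsupp.addHom_ext fun g m => ?_
    simp only [AddCommGrpCat.hom_ofHom, AddMonoidHom.comp_apply,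
      Finsupp.mapRange.addMonoidHom_apply, Finsupp.mapRange_single,
      Finsupp.mapDomain.addMonoidHom_apply, Finsupp.mapDomain_single, M.map_id]
    rfl
  map_comp f g := by
    ext : 1
    refine Finsupp.addHom_ext fun g m => ?_
    simp only [AddCommGrpCat.hom_ofHom, AddMonoidHom.comp_apply,
      Finsupp.mapRange.addMonoidHom_apply, Finsupp.mapRange_single,
      Finsupp.mapDomain.addMonoidHom_apply, Finsupp.mapDomain_single, M.map_comp,
      AddCommGrpCat.hom_comp]
    rfl

/-- The element `g ⊗ m` of `ℤ[X] ⊗ M(X)`. -/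
noncomputable def tmul {X : Gr} (g : X.group) (m : M.obj X) : (ind M).obj X :=
  (Finsupp.single g m : X.group →₀ M.obj X)

/-- The additive map `m ↦ g ⊗ m`. -/
noncomputable def tmulHom {X : Gr} (g : X.group) : M.obj X →+ (ind M).obj X :=
  Finsupp.singleAddHom (M := M.obj X) g

lemma tmul_add {X : Gr} (g : X.group) (m m' : M.obj X) : tmul g (m + m') = tmul g m + tmul g m' :=
  Finsupp.single_add g m m'

lemma tmul_sub {X : Gr} (g : X.group) (m m' : M.obj X) : tmul g (m - m') = tmul g m - tmul g m' :=
  (Finsupp.singleAddHom g).map_sub m m'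

lemma tmul_zero {X : Gr} (g : X.group) : tmul g (0 : M.obj X) = 0 :=
  Finsupp.single_zero g

lemma ind_map_tmul {X Y : Gr} (f : X ⟶ Y) (g : X.group) (m : M.obj X) :
    (ind M).map f (tmul g m) = tmul (Gr.Hom.toMonoidHom f g) (M.map f m) := by
  refine (congrArg (Finsupp.mapDomain _)
    (Finsupp.mapRange_single (f := (M.map f).hom) (hf := map_zero _))).trans ?_
  exact Finsupp.mapDomain_single

lemma ind_induction {X : Gr} {p : (ind M).obj X → Prop} (x : (ind M).obj X) (zero : p 0)
    (add : ∀ x y, p x → p y → p (x + y)) (single : ∀ g m, p (tmul g m)) : p x :=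
  Finsupp.induction_linear (motive := p) x zero add single

/-- A morphism out of an induced functor. -/
noncomputable def indLift (φ : ∀ X : Gr, X.group → M.obj X →+ N.obj X)
    (hφ : ∀ (X Y : Gr) (f : X ⟶ Y) (g : X.group) (m : M.obj X),
      φ Y (Gr.Hom.toMonoidHom f g) (M.map f m) = N.map f (φ X g m)) : ind M ⟶ N where
  app X := AddCommGrpCat.ofHom (Finsupp.liftAddHom (φ X))
  naturality X Y f := by
    ext x
    induction x using ind_induction with
    | zero => simp only [map_zero]
    | add x y hx hy => simp only [map_add, hx, hy]
    | single g m =>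
      change Finsupp.liftAddHom (φ Y) ((ind M).map f (tmul g m)) =
        N.map f (Finsupp.liftAddHom (φ X) (tmul g m))
      rw [ind_map_tmul]
      refine (Finsupp.liftAddHom_apply_single _ _ _).trans ((hφ X Y f g m).trans ?_)
      exact congrArg (N.map f) (Finsupp.liftAddHom_apply_single (φ X) g m).symm

lemma indLift_tmul (φ : ∀ X : Gr, X.group → M.obj X →+ N.obj X)
    (hφ : ∀ (X Y : Gr) (f : X ⟶ Y) (g : X.group) (m : M.obj X),
      φ Y (Gr.Hom.toMonoidHom f g) (M.map f m) = N.map f (φ X g m)) {X : Gr} (g : X.group)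
    (m : M.obj X) : (indLift φ hφ).app X (tmul g m) = φ X g m :=
  Finsupp.liftAddHom_apply_single (φ X) g m

/-- The map `g ⊗ m ↦ m`. -/
noncomputable def aug (M : FunGr.{u}) : ind M ⟶ M :=
  indLift (fun X _ => AddMonoidHom.id (M.obj X)) fun _ _ _ _ _ => rfl

@[simp] lemma aug_tmul {X : Gr} (g : X.group) (m : M.obj X) : (aug M).app X (tmul g m) = m := by
  rw [aug]
  exact indLift_tmul _ _ g m

/-- The translation `h ⊗ m ↦ gh ⊗ m`. -/
noncomputable def transl {X : Gr} (g : X.group) : (ind M).obj X →+ (ind M).obj X :=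
  translate (A := M.obj X) g

@[simp] lemma transl_tmul {X : Gr} (g h : X.group) (m : M.obj X) :
    transl g (tmul h m) = tmul (g * h) m :=
  translate_single g h m

lemma transl_one {X : Gr} (x : (ind M).obj X) : transl 1 x = x :=
  translate_one (A := M.obj X) x

lemma transl_mul {X : Gr} (g h : X.group) (x : (ind M).obj X) :
    transl (g * h) x = transl g (transl h x) :=
  translate_mul (A := M.obj X) g h x

lemma ind_map_transl {X Y : Gr} (f : X ⟶ Y) (g : X.group) (x : (ind M).obj X) :
    (ind M).map f (transl g x) = transl (Gr.Hom.toMonoidHom f g) ((ind M).map f x) := by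
  induction x using ind_induction with
  | zero => simp only [map_zero]
  | add x y hx hy => simp only [map_add, hx, hy]
  | single h m => simp only [transl_tmul, ind_map_tmul, map_mul]

@[simp] lemma aug_transl {X : Gr} (g : X.group) (x : (ind M).obj X) :
    (aug M).app X (transl g x) = (aug M).app X x := by
  induction x using ind_induction with
  | zero => simp only [map_zero]
  | add x y hx hy => simp only [map_add, hx, hy]
  | single h m => simp only [transl_tmul, aug_tmul]

/-- A subfunctor of an induced functor that is stable under translations. -/
def SubFun.IsStable (K : SubFun (ind M)) : Prop :=
  ∀ (X : Gr) (g : X.group), ∀ x ∈ K.carrier X, transl g x ∈ K.carrier X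

/-- The product of the augmentation ideal with a subfunctor of an induced functor. -/
noncomputable def SubFun.augMul (K : SubFun (ind M)) : SubFun (ind M) where
  carrier X := PolyFun.augMul (A := M.obj X) (K.carrier X)
  map_mem {X Y} f m hm := by
    refine PolyFun.augMul_le (A := M.obj X) (K := ((PolyFun.augMul (A := M.obj Y)
      (K.carrier Y)).comap ((ind M).map f).hom)) (fun g (y : (ind M).obj X) hy => ?_) hm
    change (ind M).map f (transl g y - y) ∈ PolyFun.augMul (A := M.obj Y) (K.carrier Y)
    rw [map_sub, ind_map_transl]
    exact translate_sub_mem_augMul (A := M.obj Y) _ (K.map_mem f hy)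

lemma SubFun.transl_sub_mem_augMul {K : SubFun (ind M)} {X : Gr} (g : X.group)
    {x : (ind M).obj X} (hx : x ∈ K.carrier X) : transl g x - x ∈ K.augMul.carrier X :=
  PolyFun.translate_sub_mem_augMul (A := M.obj X) g hx

lemma SubFun.augMul_le {K : SubFun (ind M)} {X : Gr} {H : AddSubgroup ((ind M).obj X)}
    (h : ∀ g, ∀ x ∈ K.carrier X, transl g x - x ∈ H) : K.augMul.carrier X ≤ H :=
  PolyFun.augMul_le (A := M.obj X) h

lemma SubFun.augMul_mono {K L : SubFun (ind M)} {X : Gr} (h : K.carrier X ≤ L.carrier X) :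
    K.augMul.carrier X ≤ L.augMul.carrier X :=
  PolyFun.augMul_mono (A := M.obj X) h

lemma SubFun.IsStable.augMul_le {K : SubFun (ind M)} (hK : K.IsStable) (X : Gr) :
    K.augMul.carrier X ≤ K.carrier X :=
  PolyFun.augMul_le_self (A := M.obj X) (hK X)

lemma SubFun.IsStable.augMul {K : SubFun (ind M)} (hK : K.IsStable) : K.augMul.IsStable :=
  fun X g _ hx => PolyFun.translate_mem_augMul (A := M.obj X) (hK X) g hx

/-- The action `g ⊗ k ↦ g k`, for a subfunctor of an induced functor. -/
noncomputable def action (K : SubFun (ind M)) : ind K.toFunctor ⟶ ind M :=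
  indLift (fun X g => (transl g).comp (K.ι.app X).hom) fun _ _ f g k =>
    (ind_map_transl f g (K.ι.app _ k)).symm

@[simp] lemma action_tmul (K : SubFun (ind M)) {X : Gr} (g : X.group) (k : K.toFunctor.obj X) :
    (action K).app X (tmul g k) = transl g (K.ι.app X k) := by
  rw [action]
  exact indLift_tmul _ _ g k

lemma action_transl (K : SubFun (ind M)) {X : Gr} (g : X.group) (x : (ind K.toFunctor).obj X) :
    (action K).app X (transl g x) = transl g ((action K).app X x) := by
  induction x using ind_induction with
  | zero => simp only [map_zero]
  | add x y hx hy => simp only [map_add, hx, hy]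
  | single h m => simp only [transl_tmul, action_tmul, transl_mul]

lemma SubFun.IsStable.action_mem {K : SubFun (ind M)} (hK : K.IsStable) (X : Gr)
    (x : (ind K.toFunctor).obj X) : (action K).app X x ∈ K.carrier X := by
  induction x using ind_induction with
  | zero => simp only [map_zero, zero_mem]
  | add x y hx hy => simpa only [map_add] using add_mem hx hy
  | single h m =>
    rw [action_tmul]
    exact hK X h _ (K.ι_mem m)

/-- The functor `X ↦ I(X) ⊗ M(X)`, where `I(X)` is the augmentation ideal of `ℤ[X]`. -/
noncomputable def redSub (M : FunGr.{u}) : SubFun (ind M) :=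
  SubFun.ker (aug M)

lemma tmul_sub_tmul_one_mem {X : Gr} (g : X.group) (m : M.obj X) :
    tmul g m - tmul 1 m ∈ (redSub M).carrier X := by
  rw [redSub, SubFun.mem_ker, map_sub, aug_tmul, aug_tmul, sub_self]

lemma sub_tmul_one_aug_mem_augMul {X : Gr} (x : (ind M).obj X) :
    x - tmul 1 ((aug M).app X x) ∈ (SubFun.top (ind M)).augMul.carrier X := by
  induction x using ind_induction with
  | zero => simp only [map_zero, tmul_zero, sub_zero, zero_mem]
  | add x y hx hy =>
    rw [map_add, tmul_add, add_sub_add_comm]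
    exact add_mem hx hy
  | single g m =>
    have := SubFun.transl_sub_mem_augMul (K := SubFun.top (ind M)) g (x := tmul 1 m) trivial
    simpa using this

lemma redSub_carrier (M : FunGr.{u}) (X : Gr) :
    (redSub M).carrier X = (SubFun.top (ind M)).augMul.carrier X := by
  apply le_antisymm
  · intro x hx
    have := sub_tmul_one_aug_mem_augMul x
    rwa [SubFun.mem_ker.1 hx, tmul_zero, sub_zero] at this
  · refine SubFun.augMul_le fun g x _ => ?_
    rw [redSub, SubFun.mem_ker, map_sub, aug_transl, sub_self]

/-- Induction on the elements of `I(X) ⊗ M(X)`. -/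
lemma redSub_induction {X : Gr} {p : (redSub M).toFunctor.obj X → Prop}
    (x : (redSub M).toFunctor.obj X) (zero : p 0) (add : ∀ x y, p x → p y → p (x + y))
    (single : ∀ g m, p ((redSub M).of (tmul g m - tmul 1 m) (tmul_sub_tmul_one_mem g m))) :
    p x := by
  -- The map y ↦ y - 1 ⊗ aug(y) is an additive projection onto I ⊗ M, so induction on y in the whole
  -- of ℤ[X] ⊗ M is enough.
  have key : ∀ y : (ind M).obj X,
      ∃ h : y - tmul 1 ((aug M).app X y) ∈ (redSub M).carrier X, p ((redSub M).of _ h) := by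
    intro y
    induction y using ind_induction with
    | zero =>
      refine ⟨by simp only [map_zero, tmul_zero, sub_zero, zero_mem], ?_⟩
      convert zero
      simp only [map_zero, tmul_zero, sub_zero]
      rfl
    | add y z hy hz =>
      obtain ⟨h₁, hy⟩ := hy
      obtain ⟨h₂, hz⟩ := hz
      have e : y + z - tmul 1 ((aug M).app X (y + z)) =
          (y - tmul 1 ((aug M).app X y)) + (z - tmul 1 ((aug M).app X z)) := by
        rw [map_add, tmul_add, add_sub_add_comm]
      refine ⟨e ▸ add_mem h₁ h₂, ?_⟩
      convert add _ _ hy hz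
      exact (redSub M).ι_injective X e
    | single g m =>
      have e : tmul g m - tmul 1 ((aug M).app X (tmul g m)) = tmul g m - tmul 1 m := by
        rw [aug_tmul]
      refine ⟨e ▸ tmul_sub_tmul_one_mem g m, ?_⟩
      convert single g m
  obtain ⟨h, hp⟩ := key ((redSub M).ι.app X x)
  convert hp
  refine (redSub M).ι_injective X ?_
  rw [SubFun.ι_of, SubFun.mem_ker.1 ((redSub M).ι_mem x), tmul_zero, sub_zero]

lemma redSub_hom_ext {G : FunGr.{u}} {α β : (redSub M).toFunctor ⟶ G}
    (h : ∀ (X : Gr) (g : X.group) (m : M.obj X),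
      α.app X ((redSub M).of _ (tmul_sub_tmul_one_mem g m)) =
        β.app X ((redSub M).of _ (tmul_sub_tmul_one_mem g m))) : α = β := by
  ext X x
  induction x using redSub_induction with
  | zero => simp only [map_zero]
  | add x y hx hy => simp only [map_add, hx, hy]
  | single g m => exact h X g m

/-- The functoriality of `ind`. -/
noncomputable def indMap (α : M ⟶ N) : ind M ⟶ ind N :=
  indLift (fun X g => (Finsupp.singleAddHom g).comp (α.app X).hom) fun X Y f g m => by
    refine Eq.trans ?_ (ind_map_tmul f g (α.app X m)).symm
    exact congrArg (tmul _) (ConcreteCategory.congr_hom (α.naturality f) m)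

@[simp] lemma indMap_tmul (α : M ⟶ N) {X : Gr} (g : X.group) (m : M.obj X) :
    (indMap α).app X (tmul g m) = tmul g (α.app X m) := by
  rw [indMap]
  exact indLift_tmul _ _ g m

lemma aug_indMap (α : M ⟶ N) {X : Gr} (x : (ind M).obj X) :
    (aug N).app X ((indMap α).app X x) = α.app X ((aug M).app X x) := by
  induction x using ind_induction with
  | zero => simp only [map_zero]
  | add x y hx hy => simp only [map_add, hx, hy]
  | single g m => simp only [indMap_tmul, aug_tmul]

lemma indMap_injective (α : M ⟶ N) {X : Gr} (hα : Function.Injective (α.app X)) :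
    Function.Injective ((indMap α).app X) := by
  have key : ((indMap α).app X).hom = Finsupp.mapRange.addMonoidHom (α.app X).hom := by
    refine Finsupp.addHom_ext fun g m => (indMap_tmul α g m).trans ?_
    exact (Finsupp.mapRange_single (f := (α.app X).hom) (hf := map_zero _)).symm
  have : Function.Injective (Finsupp.mapRange.addMonoidHom (ι := X.group) (α.app X).hom) :=
    Finsupp.mapRange_injective _ (map_zero _) hα
  rwa [← key] at this

/-- The functor `M ↦ I ⊗ M`. -/
noncomputable abbrev redInd : FunGr.{u} ⥤ FunGr.{u} where
  obj M := (redSub M).toFunctor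
  map {M N} α := (redSub N).lift ((redSub M).ι ≫ indMap α) fun X x => by
    rw [redSub, SubFun.mem_ker]
    refine (aug_indMap α _).trans ?_
    exact (congrArg (α.app X) (SubFun.mem_ker.1 ((redSub M).ι_mem x))).trans (map_zero _)
  map_id M := by
    refine redSub_hom_ext fun X g m => (redSub M).ι_injective X ?_
    refine (map_sub ((indMap (𝟙 M)).app X).hom _ _).trans ?_
    exact congrArg₂ (· - ·) (indMap_tmul (𝟙 M) g m) (indMap_tmul (𝟙 M) 1 m)
  map_comp {M N P} α β := by
    refine redSub_hom_ext fun X g m => (redSub P).ι_injective X ?_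
    have key : ∀ g, (indMap (α ≫ β)).app X (tmul g m) =
        (indMap β).app X ((indMap α).app X (tmul g m)) := by
      intro g
      simp only [indMap_tmul]
      rfl
    change (indMap (α ≫ β)).app X (tmul g m - tmul 1 m) =
      (indMap β).app X ((indMap α).app X (tmul g m - tmul 1 m))
    simp only [map_sub, key]

instance : redInd.{u}.PreservesMonomorphisms where
  preserves {M N} α _ := by
    rw [NatTrans.mono_iff_mono_app]
    intro X
    rw [AddCommGrpCat.mono_iff_injective]
    intro x y h
    refine (redSub M).ι_injective X (indMap_injective α ?_ (congrArg ((redSub N).ι.app X) h))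
    rw [← AddCommGrpCat.mono_iff_injective]
    infer_instance

end Induced

/-! ### The difference functor -/

namespace Gr

/-- The free group of rank one. -/
abbrev Z : Gr := ⟨1⟩

variable {X Y : Gr}

/-- The morphism from the free group of rank one corresponding to an element. -/
def elt (g : X.group) : Z ⟶ X := FreeGroup.lift (β := X.group) fun _ => g

lemma hom_ext_of {f g : X ⟶ Y}
    (h : ∀ i, Hom.toMonoidHom f (FreeGroup.of i) = Hom.toMonoidHom g (FreeGroup.of i)) : f = g :=
  FreeGroup.ext_hom _ _ h

lemma toMonoidHom_elt_of (g : X.group) : Hom.toMonoidHom (elt g) (FreeGroup.of 0) = g :=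
  FreeGroup.lift_apply_of

lemma elt_toMonoidHom_of (f : Z ⟶ X) : elt (Hom.toMonoidHom f (FreeGroup.of 0)) = f :=
  hom_ext_of fun i => by rw [Subsingleton.elim i 0, toMonoidHom_elt_of]

lemma elt_comp (g : X.group) (f : X ⟶ Y) : elt g ≫ f = elt (Hom.toMonoidHom f g) := by
  rw [← elt_toMonoidHom_of (elt g ≫ f)]
  exact congrArg (fun t => elt (Hom.toMonoidHom f t)) (toMonoidHom_elt_of g)

@[simp] lemma elt_one : elt (1 : X.group) = 0 :=
  (elt_toMonoidHom_of (0 : Z ⟶ X))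

/-- The canonical generator of the first factor of `Z ⨿ X`. -/
noncomputable def gen (X : Gr) : (Z ⨿ X).group :=
  Hom.toMonoidHom (coprod.inl : Z ⟶ Z ⨿ X) (FreeGroup.of 0)

@[simp] lemma elt_gen (X : Gr) : elt (gen X) = coprod.inl := elt_toMonoidHom_of _

/-- The morphism `Z ⨿ X ⟶ X` given by an element of `X`. -/
noncomputable def ins (g : X.group) : Z ⨿ X ⟶ X := coprod.desc (elt g) (𝟙 X)

lemma inr_ins (g : X.group) : coprod.inr ≫ ins g = 𝟙 X := coprod.inr_desc _ _

lemma ins_naturality (f : X ⟶ Y) (g : X.group) :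
    coprod.map (𝟙 Z) f ≫ ins (Hom.toMonoidHom f g) = ins g ≫ f := by
  ext1 <;> simp [ins, elt_comp]

/-- The Yoneda identity for the tautological element `gen X`: it recovers an element of G(Z ⨿ X)
from its specialisations. -/
lemma map_inr_ins_gen (X : Gr) :
    coprod.map (𝟙 Z) coprod.inr ≫ ins (gen X) = 𝟙 (Z ⨿ X) := by
  ext1 <;> simp [ins]

lemma toMonoidHom_ins_gen (g : X.group) : Hom.toMonoidHom (ins g) (gen X) = g := by
  have : (coprod.inl : Z ⟶ Z ⨿ X) ≫ ins g = elt g := coprod.inl_desc _ _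
  refine Eq.trans ?_ (toMonoidHom_elt_of g)
  exact congrArg (fun f => Hom.toMonoidHom f (FreeGroup.of 0)) this

end Gr

open Gr

variable {M G G' : FunGr.{u}}

/-- The functor `X ↦ G(Z ⨿ X)`. -/
noncomputable abbrev shift (G : FunGr.{u}) : FunGr.{u} where
  obj X := G.obj (Z ⨿ X)
  map f := G.map (coprod.map (𝟙 Z) f)
  map_id X := by rw [coprod.map_id_id, G.map_id]
  map_comp f g := by rw [← G.map_comp, coprod.map_map, Category.comp_id]

lemma shift_map (G : FunGr.{u}) {X Y : Gr} (f : X ⟶ Y) :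
    (shift G).map f = G.map (coprod.map (𝟙 Z) f) := rfl

/-- The morphism `G(Z ⨿ X) ⟶ G(X)` that forgets the first factor. -/
noncomputable def shiftRetraction (G : FunGr.{u}) : shift G ⟶ G where
  app X := G.map (ins 1)
  naturality X Y f := by
    have := ins_naturality f 1
    rw [map_one] at this
    rw [shift_map, ← G.map_comp, ← G.map_comp, this]

/-- The kernel of `G(Z ⨿ X) ⟶ G(X)`. -/
noncomputable def deltaSub (G : FunGr.{u}) : SubFun (shift G) := SubFun.ker (shiftRetraction G)

lemma mem_deltaSub {X : Gr} {x : G.obj (Z ⨿ X)} :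
    x ∈ (deltaSub G).carrier X ↔ G.map (ins 1) x = 0 := Iff.rfl

/-- The functoriality of `shift`. -/
noncomputable def shiftMap (α : G ⟶ G') : shift G ⟶ shift G' :=
  { app := fun X => α.app (Z ⨿ X)
    naturality := fun _ _ f => α.naturality (coprod.map (𝟙 Z) f) }

lemma naturality_apply (α : G ⟶ G') {X Y : Gr} (f : X ⟶ Y) (x : G.obj X) :
    α.app Y (G.map f x) = G'.map f (α.app X x) :=
  ConcreteCategory.congr_hom (α.naturality f) x

lemma map_comp_apply (G : FunGr.{u}) {X Y W : Gr} (f : X ⟶ Y) (g : Y ⟶ W) (x : G.obj X) :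
    G.map g (G.map f x) = G.map (f ≫ g) x :=
  (ConcreteCategory.congr_hom (G.map_comp f g) x).symm

lemma map_id_apply (G : FunGr.{u}) {X : Gr} (x : G.obj X) : G.map (𝟙 X) x = x :=
  ConcreteCategory.congr_hom (G.map_id X) x

/-- The difference functor `G ↦ (X ↦ ker (G(Z ⨿ X) ⟶ G(X)))`. -/
noncomputable abbrev delta : FunGr.{u} ⥤ FunGr.{u} where
  obj G := (deltaSub G).toFunctor
  map {G G'} α := (deltaSub G').lift ((deltaSub G).ι ≫ shiftMap α) fun X x => by
    refine mem_deltaSub.2 ?_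
    refine (naturality_apply α (ins 1) ((deltaSub G).ι.app X x)).symm.trans ?_
    exact (congrArg (α.app X) (mem_deltaSub.1 ((deltaSub G).ι_mem x))).trans (map_zero _)
  map_id G := rfl
  map_comp α β := rfl

instance : delta.{u}.PreservesZeroMorphisms where
  map_zero _ _ := rfl

instance : delta.{u}.PreservesEpimorphisms where
  preserves {G G'} α _ := by
    rw [NatTrans.epi_iff_epi_app]
    intro X
    rw [AddCommGrpCat.epi_iff_surjective]
    intro y
    have hα : Function.Surjective (α.app (Z ⨿ X)) := by
      rw [← AddCommGrpCat.epi_iff_surjective]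
      infer_instance
    obtain ⟨x, hx⟩ := hα ((deltaSub G').ι.app X y)
    have hy : G'.map (ins 1) ((deltaSub G').ι.app X y) = 0 :=
      mem_deltaSub.1 ((deltaSub G').ι_mem y)
    -- An arbitrary preimage is corrected by its component coming from X. The image is unchanged
    -- because y has no such component.
    refine ⟨(deltaSub G).of (X := X) (x - G.map coprod.inr (G.map (ins 1) x) : G.obj (Z ⨿ X)) ?_,
      (deltaSub G').ι_injective X ?_⟩
    · rw [mem_deltaSub, map_sub, map_comp_apply G coprod.inr, inr_ins, map_id_apply, sub_self]
    · refine (map_sub (α.app (Z ⨿ X)).hom _ _).trans ?_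
      have : α.app (Z ⨿ X) (G.map coprod.inr (G.map (ins 1) x)) = 0 := by
        rw [naturality_apply, naturality_apply, hx, hy, map_zero]
      exact (congrArg₂ (· - ·) hx this).trans (sub_zero _)

/-- The morphism `ind M ⟶ G` adjoint to a morphism `M ⟶ shift G`. -/
noncomputable def ofShift (η : M ⟶ shift G) : ind M ⟶ G :=
  indLift (fun X g => (G.map (ins g)).hom.comp (η.app X).hom) fun X Y f g m => by
    have h := naturality_apply η f m
    change G.map (ins (Hom.toMonoidHom f g)) (η.app Y (M.map f m)) = G.map f (G.map (ins g) _)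
    rw [h, shift_map, map_comp_apply, map_comp_apply, ins_naturality]

lemma ofShift_tmul (η : M ⟶ shift G) {X : Gr} (g : X.group) (m : M.obj X) :
    (ofShift η).app X (tmul g m) = G.map (ins g) (η.app X m) := by
  rw [ofShift]
  exact indLift_tmul _ _ g m

/-- The morphism `M ⟶ shift ((redSub M).toFunctor)` underlying the unit of the adjunction. -/
noncomputable def redUnit (M : FunGr.{u}) : M ⟶ shift (redSub M).toFunctor where
  app X := AddCommGrpCat.ofHom
    (((tmulHom (gen X) - tmulHom 1 : M.obj (Z ⨿ X) →+ (ind M).obj (Z ⨿ X)).comp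
      (M.map coprod.inr).hom).codRestrict ((redSub M).carrier (Z ⨿ X))
        fun m => tmul_sub_tmul_one_mem (gen X) (M.map coprod.inr m))
  naturality X Y f := by
    ext m
    refine (redSub M).ι_injective _ ?_
    change tmul (gen Y) (M.map coprod.inr (M.map f m)) - tmul 1 (M.map coprod.inr (M.map f m)) =
      (ind M).map (coprod.map (𝟙 Z) f) (tmul (gen X) (M.map coprod.inr m) -
        tmul 1 (M.map coprod.inr m))
    have h : Hom.toMonoidHom (coprod.map (𝟙 Z) f) (gen X) = gen Y := by
      have : (coprod.inl : Z ⟶ Z ⨿ X) ≫ coprod.map (𝟙 Z) f = coprod.inl := by simp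
      exact congrArg (fun f => Hom.toMonoidHom f (FreeGroup.of 0)) this
    simp only [map_sub, ind_map_tmul, map_comp_apply, h, map_one]
    simp only [coprod.inr_map]

lemma redUnit_app (M : FunGr.{u}) {X : Gr} (m : M.obj X) :
    (redUnit M).app X m =
      (redSub M).of _ (tmul_sub_tmul_one_mem (gen X) (M.map coprod.inr m)) := rfl

lemma map_ins_of (M : FunGr.{u}) {X : Gr} (g : X.group) (m : M.obj X) :
    (redSub M).toFunctor.map (ins g)
      ((redSub M).of _ (tmul_sub_tmul_one_mem (gen X) (M.map coprod.inr m))) =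
      (redSub M).of _ (tmul_sub_tmul_one_mem g m) := by
  refine (redSub M).ι_injective _ ?_
  rw [SubFun.ι_map, SubFun.ι_of, SubFun.ι_of, map_sub, ind_map_tmul, ind_map_tmul,
    toMonoidHom_ins_gen, map_one, map_comp_apply, inr_ins, map_id_apply]

/-- The adjunction between `I ⊗ -` and the difference functor. -/
noncomputable def redIndAdjunction : redInd.{u} ⊣ delta.{u} :=
  Adjunction.mkOfHomEquiv
    { homEquiv := fun M G =>
        -- With t the generator of Z, φ corresponds to m ↦ φ((t - 1) ⊗ m), which dies under t ↦ 1.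
        -- Conversely η gives (g - 1) ⊗ m ↦ G(ins g)(η m), because G(ins 1) vanishes on ΔG.
        { toFun := fun φ => (deltaSub G).lift (redUnit M ≫ shiftMap φ) fun X m => by
            refine mem_deltaSub.2 ?_
            refine (naturality_apply φ (ins 1) ((redUnit M).app X m)).symm.trans ?_
            rw [redUnit_app, map_ins_of M 1]
            convert map_zero (φ.app X).hom
            exact (redSub M).ι_injective X (sub_self _)
          invFun := fun η => (redSub M).ι ≫ ofShift (η ≫ (deltaSub G).ι)
          left_inv := fun φ => redSub_hom_ext fun X g m => by
            have key : ∀ g : X.group,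
                (ofShift (redUnit M ≫ shiftMap φ)).app X (tmul g m) =
                  φ.app X ((redSub M).of _ (tmul_sub_tmul_one_mem g m)) := by
              intro g
              rw [ofShift_tmul]
              refine (naturality_apply φ (ins g) ((redUnit M).app X m)).symm.trans ?_
              rw [redUnit_app, map_ins_of M g]
            change (ofShift (redUnit M ≫ shiftMap φ)).app X (tmul g m - tmul 1 m) = _
            rw [map_sub, key, key, ← map_sub]
            congr 1
            refine (redSub M).ι_injective X ?_
            change (tmul g m - tmul 1 m) - (tmul 1 m - tmul 1 m) = tmul g m - tmul 1 m
            abel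
          right_inv := fun η => by
            ext X m
            refine (deltaSub G).ι_injective X ?_
            change (ofShift (η ≫ (deltaSub G).ι)).app (Z ⨿ X)
              (tmul (gen X) (M.map coprod.inr m) - tmul 1 (M.map coprod.inr m)) =
              (deltaSub G).ι.app X (η.app X m)
            have key : ∀ g : (Z ⨿ X).group,
                (ofShift (η ≫ (deltaSub G).ι)).app (Z ⨿ X) (tmul g (M.map coprod.inr m)) =
                  G.map (coprod.map (𝟙 Z) coprod.inr ≫ ins g)
                    ((deltaSub G).ι.app X (η.app X m)) := by
              intro g
              rw [ofShift_tmul]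
              have := naturality_apply (η ≫ (deltaSub G).ι) (coprod.inr : X ⟶ Z ⨿ X) m
              rw [this, shift_map, map_comp_apply]
              rfl
            have h₁ : coprod.map (𝟙 Z) coprod.inr ≫ ins (1 : (Z ⨿ X).group) =
                ins 1 ≫ coprod.inr := by
              have := ins_naturality (coprod.inr : X ⟶ Z ⨿ X) 1
              rwa [map_one] at this
            rw [map_sub, key, key, map_inr_ins_gen, h₁, map_id_apply, ← map_comp_apply,
              mem_deltaSub.1 ((deltaSub G).ι_mem _), map_zero, sub_zero] }
      homEquiv_naturality_left_symm := fun {M' M G} α η => redSub_hom_ext fun X g m => by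
        have key : ∀ g : X.group,
            (ofShift ((α ≫ η) ≫ (deltaSub G).ι)).app X (tmul g m) =
              (ofShift (η ≫ (deltaSub G).ι)).app X ((indMap α).app X (tmul g m)) := by
          intro g
          rw [indMap_tmul, ofShift_tmul, ofShift_tmul]
          rfl
        change (ofShift ((α ≫ η) ≫ (deltaSub G).ι)).app X (tmul g m - tmul 1 m) =
          (ofShift (η ≫ (deltaSub G).ι)).app X ((indMap α).app X (tmul g m - tmul 1 m))
        simp only [map_sub, key]
      homEquiv_naturality_right := fun _ _ => rfl }

/-! ### Polynomial functors -/

section Polynomial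

open Gr

variable {F : FunGr.{u}} {d : ℕ}

/-- The vanishing of cross-effects, tested on an arbitrary coproduct. -/
lemma eq_zero_of_isPolynomialOfDegreeLE (hF : IsPolynomialOfDegreeLE d F) {X : Fin (d + 1) → Gr}
    {Y : Gr} {j : ∀ i, X i ⟶ Y} (hc : IsColimit (Cofan.mk Y j)) (e : Fin (d + 1) → (Y ⟶ Y))
    (he : ∀ i k, j k ≫ e i = if k = i then 0 else j k) (x : F.obj Y)
    (hx : ∀ i, F.map (e i) x = 0) : x = 0 := by
  let φ : Y ⟶ ∐ X := Cofan.IsColimit.desc hc (Sigma.ι X)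
  have hφ : ∀ k, j k ≫ φ = Sigma.ι X k := fun k => Cofan.IsColimit.fac hc _ k
  have h₁ : φ ≫ Sigma.desc j = 𝟙 Y := Cofan.IsColimit.hom_ext hc _ _ fun k => by
    change j k ≫ _ = j k ≫ _
    rw [← Category.assoc, hφ, Sigma.ι_desc, Category.comp_id]
  have h₂ : ∀ i, φ ≫ (retraction X i ≫ inclusion X i) = e i ≫ φ := fun i =>
    Cofan.IsColimit.hom_ext hc _ _ fun k => by
      change j k ≫ _ = j k ≫ _
      rw [← Category.assoc, hφ, ι_projector, ← Category.assoc, he]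
      split_ifs <;> simp [hφ]
  have h₃ : F.map φ x = 0 :=
    (isPolynomialOfDegreeLE_iff d F).1 hF X _ fun i => by
      rw [map_retraction_eq_zero_iff, map_comp_apply, h₂, ← map_comp_apply, hx, map_zero]
  rw [← map_id_apply F x, ← h₁, ← map_comp_apply, h₃, map_zero]

/-- It suffices to test the vanishing of cross-effects on one coproduct for each family. -/
lemma isPolynomialOfDegreeLE_of_forall_exists
    (h : ∀ X : Fin (d + 1) → Gr, ∃ (Y : Gr) (j : ∀ i, X i ⟶ Y) (_ : IsColimit (Cofan.mk Y j))
      (e : Fin (d + 1) → (Y ⟶ Y)) (_ : ∀ i k, j k ≫ e i = if k = i then 0 else j k),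
      ∀ x : F.obj Y, (∀ i, F.map (e i) x = 0) → x = 0) :
    IsPolynomialOfDegreeLE d F := by
  rw [isPolynomialOfDegreeLE_iff]
  intro X x hx
  obtain ⟨Y, j, hc, e, he, H⟩ := h X
  let φ : Y ⟶ ∐ X := Cofan.IsColimit.desc hc (Sigma.ι X)
  have hφ : ∀ k, j k ≫ φ = Sigma.ι X k := fun k => Cofan.IsColimit.fac hc _ k
  have h₁ : Sigma.desc j ≫ φ = 𝟙 _ := Sigma.hom_ext _ _ fun k => by
    rw [← Category.assoc, Sigma.ι_desc, hφ, Category.comp_id]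
  have h₂ : ∀ i, Sigma.desc j ≫ e i = (retraction X i ≫ inclusion X i) ≫ Sigma.desc j := fun i =>
    Sigma.hom_ext _ _ fun k => by
      rw [← Category.assoc, Sigma.ι_desc, he, ← Category.assoc, ι_projector]
      split_ifs <;> simp
  have h₃ : F.map (Sigma.desc j) x = 0 := H _ fun i => by
    rw [map_comp_apply, h₂, ← map_comp_apply, (map_retraction_eq_zero_iff F X i x).1 (hx i),
      map_zero]
  rw [← map_id_apply F x, ← h₁, ← map_comp_apply, h₃, map_zero]

/-- The difference functor lowers degrees. -/
lemma isPolynomialOfDegreeLE_delta (hF : IsPolynomialOfDegreeLE (d + 1) F) :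
    IsPolynomialOfDegreeLE d (delta.obj F) := by
  rw [isPolynomialOfDegreeLE_iff]
  intro X x hx
  -- A cross-effect of ΔF at X lies in the cross-effect of F at (Z, X): the condition at Z is the
  -- one defining Δ.
  let X' : Fin (d + 2) → Gr := Fin.cons Z X
  let j : ∀ i, X' i ⟶ Z ⨿ ∐ X :=
    Fin.cases (motive := fun i => X' i ⟶ Z ⨿ ∐ X) coprod.inl fun i => Sigma.ι X i ≫ coprod.inr
  let a (s : Cofan X') : Z ⟶ s.pt := s.inj 0
  let b (s : Cofan X') (i : Fin (d + 1)) : X i ⟶ s.pt := s.inj i.succ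
  have hc : IsColimit (Cofan.mk (Z ⨿ ∐ X) j) := Cofan.IsColimit.mk _
    (fun s => coprod.desc (a s) (Sigma.desc (b s)))
    (fun s i => by
      change j i ≫ _ = _
      induction i using Fin.cases with
      | zero => exact coprod.inl_desc _ _
      | succ i =>
        change (Sigma.ι X i ≫ coprod.inr) ≫ coprod.desc (a s) (Sigma.desc (b s)) = b s i
        rw [Category.assoc, coprod.inr_desc, Sigma.ι_desc])
    (fun s m hm => by
      refine coprod.hom_ext ?_ ?_
      · exact (hm 0).trans (coprod.inl_desc _ _).symm
      · rw [coprod.inr_desc]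
        refine Sigma.hom_ext _ _ fun i => ?_
        rw [Sigma.ι_desc]
        exact (Category.assoc _ _ _).symm.trans (hm i.succ))
  let e : Fin (d + 2) → (Z ⨿ ∐ X ⟶ Z ⨿ ∐ X) :=
    Fin.cons (ins 1 ≫ coprod.inr) fun i => coprod.map (𝟙 Z) (retraction X i ≫ inclusion X i)
  refine (deltaSub F).ι_injective _
    ((eq_zero_of_isPolynomialOfDegreeLE hF hc e ?_ ((deltaSub F).ι.app _ x) ?_).trans
      (map_zero _).symm)
  · intro i k
    induction i using Fin.cases with
    | zero =>
      change j k ≫ ins 1 ≫ coprod.inr = _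
      induction k using Fin.cases with
      | zero =>
        rw [if_pos rfl]
        change coprod.inl ≫ coprod.desc (elt 1) _ ≫ coprod.inr = 0
        rw [coprod.inl_desc_assoc, elt_one, zero_comp]
      | succ k =>
        rw [if_neg (Fin.succ_ne_zero k)]
        change (Sigma.ι X k ≫ coprod.inr) ≫ ins 1 ≫ coprod.inr = Sigma.ι X k ≫ coprod.inr
        rw [Category.assoc, ← Category.assoc coprod.inr, inr_ins,
          Category.id_comp]
    | succ i =>
      change j k ≫ coprod.map (𝟙 Z) (retraction X i ≫ inclusion X i) = _
      induction k using Fin.cases with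
      | zero =>
        rw [if_neg (Fin.succ_ne_zero i).symm]
        exact (coprod.inl_map _ _).trans (Category.id_comp _)
      | succ k =>
        simp only [Fin.succ_inj]
        change (Sigma.ι X k ≫ coprod.inr) ≫ coprod.map (𝟙 Z) (retraction X i ≫ inclusion X i) =
          if k = i then 0 else Sigma.ι X k ≫ coprod.inr
        rw [Category.assoc, coprod.inr_map, ← Category.assoc, ι_projector]
        split_ifs <;> simp
  · intro i
    induction i using Fin.cases with
    | zero =>
      change F.map (ins 1 ≫ coprod.inr) _ = 0
      rw [← map_comp_apply, mem_deltaSub.1 ((deltaSub F).ι_mem x), map_zero]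
    | succ i =>
      refine (congrArg ((deltaSub F).ι.app _)
        ((map_retraction_eq_zero_iff (delta.obj F) X i x).1 (hx i))).trans (map_zero _)

/-- In degree 0 an element killed by the zero endomorphism is zero, and that endomorphism factors
through `ins 1`. -/
lemma isZero_delta (hF : IsPolynomialOfDegreeLE 0 F) : IsZero (delta.obj F) := by
  refine Functor.isZero _ fun X => ?_
  have : Subsingleton ((delta.obj F).obj X) := by
    refine ⟨fun x y => (sub_eq_zero (G := (delta.obj F).obj X)).1 ?_⟩
    generalize x - y = z
    have hc : IsColimit (Cofan.mk (Z ⨿ X) (fun _ : Fin (0 + 1) => 𝟙 (Z ⨿ X))) :=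
      Cofan.IsColimit.mk _ (fun s => s.inj 0)
        (fun s i => by rw [Subsingleton.elim (α := Fin 1) i 0]; exact Category.id_comp _)
        (fun s m hm => (Category.id_comp m).symm.trans (hm 0))
    refine (deltaSub F).ι_injective _
      ((eq_zero_of_isPolynomialOfDegreeLE hF hc (fun _ => 0) ?_ ((deltaSub F).ι.app _ z) ?_).trans
        (map_zero _).symm)
    · intro i k
      rw [if_pos (Subsingleton.elim (α := Fin 1) k i), comp_zero]
    · intro i
      have : (0 : Z ⨿ X ⟶ Z ⨿ X) = ins 1 ≫ 0 := comp_zero.symm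
      rw [this, ← map_comp_apply, mem_deltaSub.1 ((deltaSub F).ι_mem z), map_zero]
  exact AddCommGrpCat.isZero_of_subsingleton _

/-- Functors that are zero if `a = 0`, or polynomial of degree less than `a`. -/
def IsPolynomialOfDegreeLT (a : ℕ) (F : FunGr.{u}) : Prop :=
  IsZero F ∨ ∃ d < a, IsPolynomialOfDegreeLE d F

lemma IsPolynomialOfDegreeLT.mono {a b : ℕ} (h : a ≤ b) (hF : IsPolynomialOfDegreeLT a F) :
    IsPolynomialOfDegreeLT b F :=
  hF.imp_right fun ⟨d, hd, hF⟩ => ⟨d, hd.trans_le h, hF⟩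

lemma IsPolynomialOfDegreeLT.isZero (hF : IsPolynomialOfDegreeLT 0 F) : IsZero F :=
  hF.elim id fun ⟨_, hd, _⟩ => absurd hd (Nat.not_lt_zero _)

/-- The zero functor plays the part of degree -∞, so Δ lowers the bound uniformly, degree 0
included. -/
lemma IsPolynomialOfDegreeLT.delta {a : ℕ} (hF : IsPolynomialOfDegreeLT (a + 1) F) :
    IsPolynomialOfDegreeLT a (delta.obj F) := by
  obtain hF | ⟨d, hd, hF⟩ := hF
  · exact Or.inl (Functor.map_isZero PolyFun.delta hF)
  · cases d with
    | zero => exact Or.inl (isZero_delta hF)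
    | succ d => exact Or.inr ⟨d, Nat.lt_of_succ_lt_succ hd, isPolynomialOfDegreeLE_delta hF⟩

end Polynomial

/-! ### Alternating sums of endomorphisms -/

section Alternating

variable {F G : FunGr.{u}} {Y : Gr}

/-- The composition of the endomorphisms `1 - F(e)` of `F(Y)`, for `e` in a list of endomorphisms
of `Y`. -/
noncomputable def alt (F : FunGr.{u}) : List (Y ⟶ Y) → F.obj Y →+ F.obj Y
  | [] => AddMonoidHom.id _
  | e :: l => alt F l - (F.map e).hom.comp (alt F l)

lemma alt_cons (e : Y ⟶ Y) (l : List (Y ⟶ Y)) (x : F.obj Y) :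
    alt F (e :: l) x = alt F l x - F.map e (alt F l x) := rfl

lemma app_alt (α : F ⟶ G) (l : List (Y ⟶ Y)) (x : F.obj Y) :
    α.app Y (alt F l x) = alt G l (α.app Y x) := by
  induction l with
  | nil => rfl
  | cons e l ih => rw [alt_cons, alt_cons, map_sub, naturality_apply, ih]

lemma SubFun.alt_mem (K : SubFun F) (l : List (Y ⟶ Y)) {x : F.obj Y} (hx : x ∈ K.carrier Y) :
    alt F l x ∈ K.carrier Y := by
  induction l with
  | nil => exact hx
  | cons e l ih => exact sub_mem ih (K.map_mem e ih)

lemma alt_perm {l l' : List (Y ⟶ Y)} (h : l.Perm l')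
    (hl : ∀ a ∈ l, ∀ b ∈ l, a ≫ b = b ≫ a) (x : F.obj Y) : alt F l x = alt F l' x := by
  induction h with
  | nil => rfl
  | cons e h ih =>
    rw [alt_cons, alt_cons, ih fun a ha b hb => hl a (by simp [ha]) b (by simp [hb])]
  | swap a b l =>
    simp only [alt_cons, map_sub, map_comp_apply, hl a (by simp) b (by simp)]
    abel
  | trans h₁ h₂ ih₁ ih₂ =>
    rw [ih₁ hl, ih₂ fun a ha b hb => hl a (h₁.mem_iff.2 ha) b (h₁.mem_iff.2 hb)]

lemma alt_eq_self (l : List (Y ⟶ Y)) (x : F.obj Y) (hx : ∀ e ∈ l, F.map e x = 0) :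
    alt F l x = x := by
  induction l with
  | nil => rfl
  | cons e l ih =>
    rw [alt_cons, ih fun a ha => hx a (by simp [ha]), hx e (by simp), sub_zero]

/-- A family of commuting endomorphisms of a group `Y` that is generated by the elements fixed by
all the endomorphisms of the family but one. -/
structure SplitFamily {n : ℕ} (e : Fin n → (Y ⟶ Y)) : Prop where
  comm : ∀ i k, e i ≫ e k = e k ≫ e i
  closure : Subgroup.closure {g : Y.group | ∃ i, ∀ k, k ≠ i → Gr.Hom.toMonoidHom (e k) g = g} = ⊤

/-- The endomorphism of a free product that is trivial on one factor and the identity on the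
others. -/
def Gr.freeProdProj {n : ℕ} (X : Fin n → Gr) (i : Fin n) : freeProd X ⟶ freeProd X :=
  freeProdDesc X fun k => if k = i then 1 else freeProdIncl X k

/-- The inclusion of a factor in a free product, as a morphism of `gr`. -/
def Gr.freeProdι {n : ℕ} (X : Fin n → Gr) (i : Fin n) : X i ⟶ freeProd X := freeProdIncl X i

lemma Gr.freeProdι_proj {n : ℕ} (X : Fin n → Gr) (i k : Fin n) :
    freeProdι X k ≫ freeProdProj X i = if k = i then 0 else freeProdι X k := by
  refine (freeProdDesc_comp_incl X _ k).trans ?_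
  split_ifs <;> rfl

lemma Gr.splitFamily_freeProdProj {n : ℕ} (X : Fin n → Gr) : SplitFamily (freeProdProj X) where
  comm i k := Cofan.IsColimit.hom_ext (isColimitCofan X) _ _ fun m => by
    change freeProdι X m ≫ _ = freeProdι X m ≫ _
    rw [← Category.assoc, ← Category.assoc, freeProdι_proj, freeProdι_proj]
    split_ifs <;> simp_all [freeProdι_proj]
  closure := by
    rw [eq_top_iff, ← FreeGroup.closure_range_of]
    refine Subgroup.closure_mono ?_
    rintro _ ⟨m, rfl⟩
    obtain ⟨⟨i, m⟩, rfl⟩ := finSigmaFinEquiv.surjective m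
    refine ⟨i, fun k hk => ?_⟩
    have h := freeProdι_proj X k i
    rw [if_neg hk.symm] at h
    have := DFunLike.congr_fun (F := (X i).group →* (freeProd X).group) h (FreeGroup.of m)
    have e : freeProdIncl X i (FreeGroup.of m) = FreeGroup.of (finSigmaFinEquiv ⟨i, m⟩) :=
      FreeGroup.map.of
    rw [← e]
    exact this

/-- A functor on which an iterate of the alternating sums over `d + 1` endomorphisms vanishes is
polynomial of degree at most `d`. -/
lemma isPolynomialOfDegreeLE_of_iterate_alt {d N : ℕ}
    (h : ∀ (Y : Gr) (e : Fin (d + 1) → (Y ⟶ Y)), SplitFamily e → ∀ x : F.obj Y,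
      (alt F (List.ofFn e))^[N] x = 0) : IsPolynomialOfDegreeLE d F := by
  refine isPolynomialOfDegreeLE_of_forall_exists fun X => ⟨Gr.freeProd X, Gr.freeProdι X,
    Gr.isColimitCofan X, Gr.freeProdProj X, Gr.freeProdι_proj X, fun x hx => ?_⟩
  -- An element of the cross-effect is fixed by the alternating sum, hence by all its iterates.
  rw [← h _ _ (Gr.splitFamily_freeProdProj X) x]
  refine (Function.iterate_fixed (alt_eq_self _ x fun e he => ?_) N).symm
  obtain ⟨i, rfl⟩ := (List.mem_ofFn' _ _).1 he
  exact hx i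

end Alternating

/-! ### Syzygies of products with the augmentation ideal -/

section Syzygy

variable {M : FunGr.{u}}

/-- The short exact sequence `0 ⟶ I ⊗ M ⟶ ℤ[-] ⊗ M ⟶ M ⟶ 0`. -/
lemma shortExact_aug (M : FunGr.{u}) :
    ∃ w, (ShortComplex.mk (redSub M).ι (aug M) w).ShortExact := by
  refine ⟨?_, shortExact_of_pointwise (redSub M).ι_injective (fun X m => ⟨tmul 1 m, aug_tmul 1 m⟩)
    fun X x hx => ⟨(redSub M).of x hx, rfl⟩⟩
  ext X x
  exact (redSub M).ι_mem x

/-- The kernel of the action `ℤ[-] ⊗ K ⟶ K`. -/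
noncomputable def syzygy (K : SubFun (ind M)) : SubFun (ind K.toFunctor) := SubFun.ker (action K)

lemma isStable_syzygy (K : SubFun (ind M)) : (syzygy K).IsStable := fun X g x hx => by
  rw [syzygy, SubFun.mem_ker] at hx ⊢
  rw [action_transl, hx, map_zero]

lemma shortExact_syzygy {K : SubFun (ind M)} (hK : K.IsStable) :
    ∃ w, (ShortComplex.mk (syzygy K).ι (K.lift (action K) hK.action_mem) w).ShortExact := by
  refine ⟨?_, shortExact_of_pointwise (syzygy K).ι_injective
    (fun X k => ⟨tmul 1 k, K.ι_injective X ?_⟩)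
    fun X x hx => ⟨(syzygy K).of x (congrArg (K.ι.app X) hx), rfl⟩⟩
  · ext X x
    exact K.ι_injective X ((syzygy K).ι_mem x)
  · exact (action_tmul K 1 k).trans (transl_one _)

lemma action_mem_augMul (K : SubFun (ind M)) {X : Gr} {x : (ind K.toFunctor).obj X}
    (hx : x ∈ (redSub K.toFunctor).carrier X) : (action K).app X x ∈ K.augMul.carrier X := by
  have key : ∀ y : (ind K.toFunctor).obj X, (action K).app X y -
      K.ι.app X ((aug K.toFunctor).app X y) ∈ K.augMul.carrier X := by
    intro y
    induction y using ind_induction with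
    | zero => simp only [map_zero, sub_zero, zero_mem]
    | add y z hy hz =>
      simp only [map_add]
      rw [add_sub_add_comm]
      exact add_mem hy hz
    | single g k =>
      rw [action_tmul, aug_tmul]
      exact SubFun.transl_sub_mem_augMul g (K.ι_mem k)
  simpa only [SubFun.mem_ker.1 hx, map_zero, sub_zero] using key x

lemma exists_action_eq (K : SubFun (ind M)) {X : Gr} {y : (ind M).obj X}
    (hy : y ∈ K.augMul.carrier X) :
    ∃ x ∈ (redSub K.toFunctor).carrier X, (action K).app X x = y := by
  refine SubFun.augMul_le (K := K)
    (H := ((redSub K.toFunctor).carrier X).map ((action K).app X).hom) (fun g k hk => ?_) hy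
  refine ⟨_, tmul_sub_tmul_one_mem g (K.of k hk), ?_⟩
  refine (map_sub ((action K).app X).hom _ _).trans ?_
  exact congrArg₂ (· - ·) (action_tmul K g _) ((action_tmul K 1 _).trans (transl_one _))

/-- The freeness of the augmentation ideal: the relations in `I ⊗ K ⟶ I · K` come from the
relations in `ℤ[-] ⊗ K ⟶ K`. -/
lemma mem_augMul_syzygy_iff (K : SubFun (ind M)) {X : Gr} {x : (ind K.toFunctor).obj X} :
    x ∈ (syzygy K).augMul.carrier X ↔
      x ∈ (redSub K.toFunctor).carrier X ∧ (action K).app X x = 0 := by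
  constructor
  · intro hx
    constructor
    · rw [redSub_carrier]
      exact SubFun.augMul_mono (K := syzygy K) (L := SubFun.top _) le_top hx
    · exact (isStable_syzygy K).augMul_le X hx
  · rintro ⟨hx, hx₀⟩
    rw [redSub_carrier] at hx
    obtain ⟨m, -, rfl⟩ := exists_eq_sum_of_mem_augMul (A := K.toFunctor.obj X) (H := ⊤)
      (fun _ _ _ => trivial) hx
    -- Applying the action to x = ∑ (xₖ - 1)mₖ gives 0 = ∑ (xₖ - 1)·action(mₖ); uniqueness of
    -- coefficients makes every mₖ a relation.
    have h : ∀ k, (action K).app X (m k) = 0 := by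
      refine eq_zero_of_sum_translate_sub_eq_zero (A := M.obj X)
        (fun k => (action K).app X (m k)) ?_
      refine Eq.trans ?_ hx₀
      refine Eq.trans ?_ (map_sum ((action K).app X).hom _ _).symm
      refine Finset.sum_congr rfl fun k _ => ?_
      refine Eq.trans ?_ (map_sub ((action K).app X).hom _ _).symm
      exact congrArg (· - (action K).app X (m k)) (action_transl K _ _).symm
    exact sum_mem fun k _ =>
      SubFun.transl_sub_mem_augMul (K := syzygy K) (FreeGroup.of k) (x := m k) (h k)

/-- For stable K this is 0 → R → ℤ[-] ⊗ K → K → 0 tensored over the group ring with the free right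
module I. -/
lemma shortExact_augMul (K : SubFun (ind M)) :
    ∃ (f : (syzygy K).augMul.toFunctor ⟶ redInd.obj K.toFunctor)
      (g : redInd.obj K.toFunctor ⟶ K.augMul.toFunctor) (w : f ≫ g = 0),
      (ShortComplex.mk f g w).ShortExact := by
  refine ⟨(redSub K.toFunctor).lift (syzygy K).augMul.ι
      fun X x => ((mem_augMul_syzygy_iff K).1 ((syzygy K).augMul.ι_mem x)).1,
    K.augMul.lift ((redSub K.toFunctor).ι ≫ action K)
      fun X x => action_mem_augMul K ((redSub K.toFunctor).ι_mem x), ?_, ?_⟩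
  · ext X x
    exact K.augMul.ι_injective X ((mem_augMul_syzygy_iff K).1 ((syzygy K).augMul.ι_mem x)).2
  · refine shortExact_of_pointwise
      (fun X x y h => (syzygy K).augMul.ι_injective X (congrArg ((redSub K.toFunctor).ι.app X) h))
      (fun X y => ?_) fun X x hx => ?_
    · obtain ⟨x, hx, h⟩ := exists_action_eq K (K.augMul.ι_mem y)
      exact ⟨(redSub K.toFunctor).of x hx, K.augMul.ι_injective X h⟩
    · exact ⟨(syzygy K).augMul.of _ ((mem_augMul_syzygy_iff K).2
        ⟨(redSub K.toFunctor).ι_mem x, congrArg (K.augMul.ι.app X) hx⟩), rfl⟩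

end Syzygy

/-! ### Functors orthogonal to polynomial functors -/

section Orthogonal

open Abelian

variable [HasExt.{w'} FunGr.{u}] {M N : FunGr.{u}} {a : ℕ}

/-- A functor is orthogonal to the polynomial functors of degree less than `a` if there are no
nonzero extensions between them. -/
def Orthogonal (a : ℕ) (K : FunGr.{u}) : Prop :=
  ∀ G : FunGr.{u}, IsPolynomialOfDegreeLT a G → ∀ n, Subsingleton (Ext K G n)

lemma Orthogonal.mono {b : ℕ} (h : a ≤ b) {K : FunGr.{u}} (hK : Orthogonal b K) :
    Orthogonal a K :=
  fun G hG => hK G (hG.mono h)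

lemma orthogonal_zero (K : FunGr.{u}) : Orthogonal 0 K := fun G hG n =>
  subsingleton_ext_of_forall fun x => by
    rw [← x.comp_mk₀_id, hG.isZero.eq_of_src (𝟙 G) 0, Ext.mk₀_zero, Ext.comp_zero]

lemma orthogonal_of_isZero {K : FunGr.{u}} (hK : IsZero K) : Orthogonal a K := fun G _ n =>
  subsingleton_ext_of_forall fun x => by
    rw [← x.mk₀_id_comp, hK.eq_of_src (𝟙 K) 0, Ext.mk₀_zero, Ext.zero_comp]

section

variable {S : ShortComplex FunGr.{u}} (hS : S.ShortExact)

include hS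

lemma Orthogonal.X₂ (h₁ : Orthogonal a S.X₁) (h₃ : Orthogonal a S.X₃) : Orthogonal a S.X₂ :=
  fun G hG n => subsingleton_ext_X₂ hS G (h₁ G hG n) (h₃ G hG n)

lemma Orthogonal.X₁ (h₂ : Orthogonal a S.X₂) (h₃ : Orthogonal a S.X₃) : Orthogonal a S.X₁ :=
  fun G hG n => subsingleton_ext_X₁ hS G (h₂ G hG n) (h₃ G hG (n + 1))

end

lemma orthogonal_sigma {J : Type u} {K : J → FunGr.{u}} (h : ∀ j, Orthogonal a (K j)) :
    Orthogonal a (∐ K) :=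
  fun G hG n => subsingleton_ext_sigma K n G fun j => h j G hG n

/-- By adjunction, extensions of M by ΔG control those of I ⊗ M by G, and Δ lowers the degree of G
by one. -/
lemma orthogonal_redInd (hM : Orthogonal a M) : Orthogonal (a + 1) (redInd.obj M) :=
  fun G hG n => subsingleton_ext_of_adjunction redIndAdjunction n M G (hM _ hG.delta n)

lemma orthogonal_ind (hM : Orthogonal a M) : Orthogonal a (ind M) := by
  obtain ⟨_, hS⟩ := shortExact_aug M
  exact Orthogonal.X₂ hS ((orthogonal_redInd hM).mono a.le_succ) hM

lemma orthogonal_syzygy {K : SubFun (ind M)} (hK : K.IsStable) (h : Orthogonal a K.toFunctor) :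
    Orthogonal a (syzygy K).toFunctor := by
  obtain ⟨_, hS⟩ := shortExact_syzygy hK
  exact Orthogonal.X₁ hS (orthogonal_ind h) h

/-- Multiplication by the augmentation ideal raises the order of orthogonality. -/
theorem orthogonal_augMul {K : SubFun (ind M)} (hK : K.IsStable)
    (h : Orthogonal a K.toFunctor) : Orthogonal (a + 1) K.augMul.toFunctor := by
  intro G hG n
  induction n generalizing M with
  | zero =>
    obtain ⟨f, g, w, hS⟩ := shortExact_augMul K
    exact subsingleton_ext_zero_X₃ hS G (orthogonal_redInd h G hG 0)
  | succ n ih =>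
    obtain ⟨f, g, w, hS⟩ := shortExact_augMul K
    -- Ext^(n+1)(I · K, G) lies between Ext^n(I · R, G) and Ext^(n+1)(I ⊗ K, G). The first vanishes
    -- by induction applied to the syzygy R, which is stable and as orthogonal as K.
    exact subsingleton_ext_succ_X₃ hS G (ih (isStable_syzygy K) (orthogonal_syzygy hK h))
      (orthogonal_redInd h G hG (n + 1))

end Orthogonal

/-! ### Filtrations adapted to polynomial functors -/

section Extend

variable {M : FunGr.{u}}

/-- The subfunctor `1 ⊗ K + I · P` of an induced functor. -/
noncomputable def SubFun.extend (K : SubFun M) (P : SubFun (ind M)) : SubFun (ind M) where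
  carrier X := (K.carrier X).map (tmulHom 1) ⊔ P.augMul.carrier X
  map_mem {X Y} f x hx := by
    obtain ⟨_, ⟨m, hm, rfl⟩, y, hy, rfl⟩ := AddSubgroup.mem_sup.1 hx
    rw [map_add]
    refine AddSubgroup.add_mem_sup ⟨M.map f m, K.map_mem f hm, ?_⟩ (P.augMul.map_mem f hy)
    refine Eq.trans ?_ (ind_map_tmul f 1 m).symm
    rw [map_one]
    rfl

variable {K : SubFun M} {P : SubFun (ind M)} {X : Gr}

lemma SubFun.mem_extend {x : (ind M).obj X} :
    x ∈ (K.extend P).carrier X ↔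
      ∃ m ∈ K.carrier X, ∃ y ∈ P.augMul.carrier X, tmul 1 m + y = x := by
  refine AddSubgroup.mem_sup.trans ⟨?_, ?_⟩
  · rintro ⟨_, ⟨m, hm, rfl⟩, y, hy, rfl⟩
    exact ⟨m, hm, y, hy, rfl⟩
  · rintro ⟨m, hm, y, hy, rfl⟩
    exact ⟨_, ⟨m, hm, rfl⟩, y, hy, rfl⟩

lemma SubFun.tmul_one_mem_extend {m : M.obj X} (hm : m ∈ K.carrier X) :
    tmul 1 m ∈ (K.extend P).carrier X :=
  SubFun.mem_extend.2 ⟨m, hm, 0, zero_mem _, add_zero _⟩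

lemma SubFun.augMul_le_extend : P.augMul.carrier X ≤ (K.extend P).carrier X :=
  le_sup_right

lemma SubFun.extend_le (hP : P.IsStable) (h : ∀ m ∈ K.carrier X, tmul 1 m ∈ P.carrier X) :
    (K.extend P).carrier X ≤ P.carrier X := by
  intro x hx
  obtain ⟨m, hm, y, hy, rfl⟩ := SubFun.mem_extend.1 hx
  exact add_mem (h m hm) (hP.augMul_le X hy)

lemma SubFun.isStable_extend (hP : P.IsStable)
    (h : ∀ X, ∀ m ∈ K.carrier X, tmul 1 m ∈ P.carrier X) : (K.extend P).IsStable := by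
  intro X g x hx
  obtain ⟨m, hm, y, hy, rfl⟩ := SubFun.mem_extend.1 hx
  -- g ⊗ m = 1 ⊗ m + (g - 1)(1 ⊗ m), and the last term is in I · P because 1 ⊗ m is in P.
  refine SubFun.mem_extend.2 ⟨m, hm, (transl g (tmul 1 m) - tmul 1 m) + transl g y,
    add_mem (SubFun.transl_sub_mem_augMul g (h X m hm)) (hP.augMul X g y hy), ?_⟩
  rw [map_add]
  abel

lemma aug_eq_zero_of_mem_augMul {x : (ind M).obj X} (hx : x ∈ P.augMul.carrier X) :
    (aug M).app X x = 0 := by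
  refine SubFun.mem_ker.1 ?_
  rw [← redSub, redSub_carrier]
  exact SubFun.augMul_mono (K := P) (L := SubFun.top _) le_top hx

lemma aug_tmul_one_add {x : (ind M).obj X} (hx : x ∈ P.augMul.carrier X) (m : M.obj X) :
    (aug M).app X (tmul 1 m + x) = m := by
  rw [map_add, aug_tmul, aug_eq_zero_of_mem_augMul hx, add_zero]

/-- The short exact sequence `0 ⟶ I · P ⟶ 1 ⊗ K + I · P ⟶ K ⟶ 0`. -/
lemma shortExact_extend (K : SubFun M) (P : SubFun (ind M)) :
    ∃ (f : P.augMul.toFunctor ⟶ (K.extend P).toFunctor) (g : (K.extend P).toFunctor ⟶ K.toFunctor)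
      (w : f ≫ g = 0), (ShortComplex.mk f g w).ShortExact := by
  have h : ∀ X (x : (K.extend P).toFunctor.obj X),
      (aug M).app X ((K.extend P).ι.app X x) ∈ K.carrier X := by
    intro X x
    obtain ⟨m, hm, y, hy, e⟩ := SubFun.mem_extend.1 ((K.extend P).ι_mem x)
    rw [← e, aug_tmul_one_add hy]
    exact hm
  refine ⟨(K.extend P).lift P.augMul.ι fun X x => SubFun.augMul_le_extend (P.augMul.ι_mem x),
    K.lift ((K.extend P).ι ≫ aug M) h, ?_, ?_⟩
  · ext X x
    exact K.ι_injective X (aug_eq_zero_of_mem_augMul (P.augMul.ι_mem x))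
  · refine shortExact_of_pointwise
      (fun X x y h => P.augMul.ι_injective X (congrArg ((K.extend P).ι.app X) h))
      (fun X m => ?_) fun X x hx => ?_
    · exact ⟨(K.extend P).of _ (SubFun.tmul_one_mem_extend (K.ι_mem m)),
        K.ι_injective X (aug_tmul 1 _)⟩
    · obtain ⟨m, hm, y, hy, e⟩ := SubFun.mem_extend.1 ((K.extend P).ι_mem x)
      have hx : (aug M).app X ((K.extend P).ι.app X x) = 0 := congrArg (K.ι.app X) hx
      rw [← e, aug_tmul_one_add hy] at hx
      subst hx
      rw [tmul_zero, zero_add] at e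
      exact ⟨P.augMul.of y hy, (K.extend P).ι_injective X e⟩

end Extend

/-! ### Alternating sums on induced functors -/

section AltInd

variable {M : FunGr.{u}} {Y : Gr}

lemma alt_transl (l : List (Y ⟶ Y)) (g : Y.group) (hg : ∀ e ∈ l, Gr.Hom.toMonoidHom e g = g)
    (x : (ind M).obj Y) : alt (ind M) l (transl g x) = transl g (alt (ind M) l x) := by
  induction l with
  | nil => rfl
  | cons e l ih =>
    rw [alt_cons, alt_cons, ih fun a ha => hg a (by simp [ha]), ind_map_transl, hg e (by simp),
      map_sub]

lemma alt_tmul_one (l : List (Y ⟶ Y)) (m : M.obj Y) :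
    alt (ind M) l (tmul 1 m) = tmul 1 (alt M l m) := by
  induction l with
  | nil => rfl
  | cons e l ih => rw [alt_cons, alt_cons, ih, ind_map_tmul, map_one, tmul_sub]

/-- Sets aside the only endomorphism that may move a given generator; if it does not occur, any
entry is set aside. -/
lemma exists_perm_cons_notMem {ι : Type*} [DecidableEq ι] (i : ι) {l : List ι} (hl : l.Nodup)
    {k : ℕ} (hk : l.length = k + 1) :
    ∃ c l', l.Perm (c :: l') ∧ l'.Nodup ∧ l'.length = k ∧ i ∉ l' := by
  by_cases hi : i ∈ l
  · refine ⟨i, l.erase i, List.perm_cons_erase hi, hl.erase i, ?_, hl.not_mem_erase⟩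
    rw [List.length_erase_of_mem hi, hk, Nat.add_sub_cancel]
  · cases l with
    | nil => simp at hk
    | cons c l =>
      exact ⟨c, l, List.Perm.refl _, (List.nodup_cons.1 hl).2, by simpa using hk,
        fun h => hi (List.mem_cons_of_mem _ h)⟩

variable {n : ℕ} {e : Fin n → (Y ⟶ Y)}

/-- If g is fixed by all endomorphisms but one, the k others satisfy alt((g - 1)y) = (g - 1)alt(y),
and `hA` applies to alt(y); the endomorphism set aside preserves the target. Such g generate the
group, and the property passes to products and inverses. -/
lemma alt_mem_extend (he : SplitFamily e) {K L : SubFun M} {P : SubFun (ind M)}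
    (hP : P.IsStable) {k : ℕ}
    (hM : ∀ l : List (Fin n), l.Nodup → l.length = k + 1 →
      ∀ m ∈ K.carrier Y, alt M (l.map e) m ∈ L.carrier Y)
    (hA : ∀ l : List (Fin n), l.Nodup → l.length = k →
      ∀ y ∈ P.carrier Y, alt (ind M) (l.map e) y ∈ (K.extend P).carrier Y)
    (l : List (Fin n)) (hl : l.Nodup) (hk : l.length = k + 1) {x : (ind M).obj Y}
    (hx : x ∈ (K.extend P).carrier Y) :
    alt (ind M) (l.map e) x ∈ (L.extend (K.extend P)).carrier Y := by
  have key : ∀ g : Y.group, ∀ y ∈ P.carrier Y,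
      alt (ind M) (l.map e) (transl g y - y) ∈ (L.extend (K.extend P)).carrier Y := by
    intro g
    have hg : g ∈ (⊤ : Subgroup Y.group) := trivial
    rw [← he.closure] at hg
    induction hg using Subgroup.closure_induction with
    | mem g hg =>
      intro y hy
      obtain ⟨i, hi⟩ := hg
      obtain ⟨c, l', hll', hl', hk', hil'⟩ := exists_perm_cons_notMem i hl hk
      have hcomm : ∀ a ∈ l.map e, ∀ b ∈ l.map e, a ≫ b = b ≫ a := by
        intro a ha b hb
        obtain ⟨i, -, rfl⟩ := List.mem_map.1 ha
        obtain ⟨j, -, rfl⟩ := List.mem_map.1 hb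
        exact he.comm i j
      rw [alt_perm (hll'.map e) hcomm, List.map_cons, alt_cons]
      have : alt (ind M) (l'.map e) (transl g y - y) ∈ (L.extend (K.extend P)).carrier Y := by
        rw [map_sub, alt_transl _ g fun a ha => ?_]
        · exact SubFun.augMul_le_extend (SubFun.transl_sub_mem_augMul g (hA l' hl' hk' y hy))
        · obtain ⟨j, hj, rfl⟩ := List.mem_map.1 ha
          exact hi j fun h => hil' (h ▸ hj)
      exact sub_mem this (SubFun.map_mem _ _ this)
    | one =>
      intro y _
      rw [transl_one, sub_self, map_zero]
      exact zero_mem _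
    | mul g h _ _ ihg ihh =>
      intro y hy
      have := add_mem (ihg _ (hP Y h y hy)) (ihh y hy)
      rwa [← map_add, ← transl_mul, sub_add_sub_cancel] at this
    | inv g _ ih =>
      intro y hy
      have := ih _ (hP Y g⁻¹ y hy)
      rw [← transl_mul, mul_inv_cancel, transl_one] at this
      rw [← neg_sub, map_neg]
      exact neg_mem this
  obtain ⟨m, hm, y, hy, rfl⟩ := SubFun.mem_extend.1 hx
  rw [map_add, alt_tmul_one]
  refine add_mem (SubFun.tmul_one_mem_extend (hM l hl hk m hm)) ?_
  exact SubFun.augMul_le (K := P)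
    (H := ((L.extend (K.extend P)).carrier Y).comap (alt (ind M) (l.map e))) key hy

end AltInd

/-! ### Filtrations by powers of the augmentation ideal -/

section Filtration

variable [HasExt.{w'} FunGr.{u}]

/-- A decreasing filtration whose `k`-th term is orthogonal to the polynomial functors of degree
less than `k`, and whose `k`-th graded piece is polynomial of degree at most `k`. -/
structure PolyFiltration (M : FunGr.{u}) where
  /-- the terms of the filtration -/
  K : ℕ → SubFun M
  zero : ∀ X, (K 0).carrier X = ⊤
  succ_le : ∀ k X, (K (k + 1)).carrier X ≤ (K k).carrier X
  orthogonal : ∀ k, Orthogonal k (K k).toFunctor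
  -- The size n of the family is independent of k, since the inductive proof for induced functors
  -- passes to shorter lists.
  alt_mem : ∀ (k : ℕ) (Y : Gr) (n : ℕ) (e : Fin n → (Y ⟶ Y)), SplitFamily e →
    ∀ l : List (Fin n), l.Nodup → l.length = k + 1 →
      ∀ x ∈ (K k).carrier Y, alt M (l.map e) x ∈ (K (k + 1)).carrier Y

namespace PolyFiltration

variable {M : FunGr.{u}} (Φ : PolyFiltration M)

/-- The terms of the induced filtration, shifted by one. -/
noncomputable def indTerm : ℕ → SubFun (ind M)
  -- Terms 0 and 1 are both the whole functor, so the recursion L₍ₖ₊₁₎ = 1 ⊗ Kₖ + I · Lₖ needs no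
  -- negative index. Thus L₍ₖ₊₁₎ is the sum of the Iⁱ ⊗ K₍ₖ₋ᵢ₎.
  | 0 => SubFun.top _
  | k + 1 => (Φ.K k).extend (indTerm k)

lemma isStable_indTerm_and (k : ℕ) : (Φ.indTerm k).IsStable ∧
    ∀ X, ∀ m ∈ (Φ.K k).carrier X, tmul 1 m ∈ (Φ.indTerm k).carrier X := by
  induction k with
  | zero => exact ⟨fun _ _ _ _ => trivial, fun _ _ _ => trivial⟩
  | succ k ih => exact ⟨SubFun.isStable_extend ih.1 ih.2,
      fun X m hm => SubFun.tmul_one_mem_extend (Φ.succ_le k X hm)⟩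

lemma indTerm_one (X : Gr) : (Φ.indTerm 1).carrier X = ⊤ := by
  rw [eq_top_iff]
  intro x _
  refine SubFun.mem_extend.2 ⟨(aug M).app X x, ?_, _, sub_tmul_one_aug_mem_augMul x, by abel⟩
  rw [Φ.zero]
  trivial

/-- L₍ₖ₊₂₎ is an extension of K₍ₖ₊₁₎ by I · L₍ₖ₊₁₎, and multiplication by I supplies the order
missing from L₍ₖ₊₁₎. -/
lemma orthogonal_indTerm (k : ℕ) : Orthogonal k (Φ.indTerm (k + 1)).toFunctor := by
  induction k with
  | zero => exact orthogonal_zero _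
  | succ k ih =>
    obtain ⟨f, g, w, hS⟩ := shortExact_extend (Φ.K (k + 1)) (Φ.indTerm (k + 1))
    exact Orthogonal.X₂ hS (orthogonal_augMul (Φ.isStable_indTerm_and (k + 1)).1 ih)
      (Φ.orthogonal (k + 1))

lemma alt_mem_indTerm {Y : Gr} {n : ℕ} {e : Fin n → (Y ⟶ Y)} (he : SplitFamily e) (k : ℕ)
    (l : List (Fin n)) (hl : l.Nodup) (hk : l.length = k) {x : (ind M).obj Y}
    (hx : x ∈ (Φ.indTerm k).carrier Y) :
    alt (ind M) (l.map e) x ∈ (Φ.indTerm (k + 1)).carrier Y := by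
  induction k generalizing l x with
  | zero =>
    rw [indTerm_one]
    trivial
  | succ k ih =>
    exact alt_mem_extend he (Φ.isStable_indTerm_and k).1
      (fun l hl hk m hm => Φ.alt_mem k Y n e he l hl hk m hm)
      (fun l hl hk y hy => ih l hl hk hy) l hl hk hx

/-- The filtration of an induced functor. -/
noncomputable def induced : PolyFiltration (ind M) where
  K k := Φ.indTerm (k + 1)
  zero := Φ.indTerm_one
  succ_le k X := SubFun.extend_le (Φ.isStable_indTerm_and (k + 1)).1
    ((Φ.isStable_indTerm_and (k + 1)).2 X)
  orthogonal := Φ.orthogonal_indTerm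
  alt_mem k _ _ _ he l hl hk _ hx := Φ.alt_mem_indTerm he (k + 1) l hl hk hx

/-- The filtration of a constant functor. -/
def const (A : AddCommGrpCat.{u}) : PolyFiltration ((Functor.const Gr).obj A) where
  K
    | 0 => SubFun.top _
    | _ + 1 => SubFun.bot _
  zero _ := rfl
  succ_le
    | 0, _ => le_top
    | _ + 1, _ => le_rfl
  orthogonal
    | 0 => orthogonal_zero _
    | k + 1 => orthogonal_of_isZero (Functor.isZero _ fun X => by
        have : Subsingleton ((SubFun.bot ((Functor.const Gr).obj A)).toFunctor.obj X) :=
          inferInstanceAs (Subsingleton (⊥ : AddSubgroup A))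
        exact AddCommGrpCat.isZero_of_subsingleton _)
  alt_mem
    | 0, Y, n, e, _, l, _, hl, x, _ => by
      obtain ⟨i, rfl⟩ := List.length_eq_one_iff.1 hl
      exact sub_self x
    | k + 1, Y, n, e, _, l, _, _, x, hx => by
      obtain rfl : x = 0 := hx
      exact map_zero _

include Φ in
/-- Iterated alternating sums move elements down the filtration. -/
lemma iterate_alt_mem (d : ℕ) {Y : Gr} {e : Fin (d + 1) → (Y ⟶ Y)} (he : SplitFamily e)
    (x : M.obj Y) (k : ℕ) (hk : k ≤ d + 1) :
    (alt M (List.ofFn e))^[k] x ∈ (Φ.K k).carrier Y := by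
  induction k with
  | zero =>
    rw [Φ.zero]
    trivial
  | succ k ih =>
    rw [Function.iterate_succ_apply']
    have h := ih (by lia)
    generalize (alt M (List.ofFn e))^[k] x = y at h
    let l := (List.finRange (d + 1))
    have hl : List.ofFn e = l.map e := List.ofFn_eq_map
    -- The last k + 1 of the d + 1 endomorphisms already lead from `K k` to `K (k + 1)`; the first d
    -- - k preserve that subfunctor.
    have h₁ := Φ.alt_mem k Y _ e he (l.drop (d - k)) ((List.nodup_finRange _).drop)
      (by simp [l]; lia) y h
    have h₂ : ∀ (l₁ l₂ : List (Y ⟶ Y)), alt M (l₁ ++ l₂) y = alt M l₁ (alt M l₂ y) := by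
      intro l₁ l₂
      induction l₁ with
      | nil => rfl
      | cons a l₁ ih => rw [List.cons_append, alt_cons, alt_cons, ih]
    rw [hl, ← List.take_append_drop (d - k) l, List.map_append, h₂]
    exact SubFun.alt_mem _ _ h₁

end PolyFiltration

end Filtration

/-! ### Covers by projective functors -/

section Cover

open Abelian Gr

/-- The constant functor with value `ℤ`. -/
abbrev constInt : FunGr.{u} := (Functor.const Gr).obj (AddCommGrpCat.of (ULift.{u} ℤ))

/-- The morphism from the constant functor given by an element of the value at the trivial
group. -/
noncomputable def ofInitial {F : FunGr.{u}} (y : F.obj (⊥_ Gr)) : constInt.{u} ⟶ F where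
  app X := AddCommGrpCat.ofHom ((zmultiplesHom _ (F.map (initial.to X) y)).comp
    AddEquiv.ulift.toAddMonoidHom)
  naturality X Y f := by
    ext n
    change n.down • F.map (initial.to Y) y = F.map f (n.down • F.map (initial.to X) y)
    rw [map_zsmul, map_comp_apply, initial.to_comp]

lemma ofInitial_app_one {F : FunGr.{u}} (y : F.obj (⊥_ Gr)) :
    (ofInitial y).app (⊥_ Gr) (ULift.up (1 : ℤ)) = y := by
  change (1 : ℤ) • F.map (initial.to (⊥_ Gr)) y = y
  rw [one_zsmul, Subsingleton.elim (initial.to (⊥_ Gr)) (𝟙 _), map_id_apply]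

lemma constInt_hom_ext {F : FunGr.{u}} {f g : constInt.{u} ⟶ F}
    (h : f.app (⊥_ Gr) (ULift.up (1 : ℤ)) = g.app (⊥_ Gr) (ULift.up (1 : ℤ))) : f = g := by
  ext X x
  have key : ∀ f : constInt.{u} ⟶ F, f.app X x =
      x.down • F.map (initial.to X) (f.app (⊥_ Gr) (ULift.up (1 : ℤ))) := by
    intro f
    rw [← naturality_apply f, ← map_zsmul]
    congr 1
    exact ULift.ext _ _ (by simp)
  rw [key, key, h]

/-- `constInt` is ℤ[Hom(0, -)] with 0 the initial object, so by Yoneda maps out of it are values at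
0. -/
instance : Projective constInt.{u} where
  factors {E X} f e _ := by
    have he : Function.Surjective (e.app (⊥_ Gr)) := by
      rw [← AddCommGrpCat.epi_iff_surjective]
      infer_instance
    obtain ⟨y, hy⟩ := he (f.app (⊥_ Gr) (ULift.up (1 : ℤ)))
    refine ⟨ofInitial y, constInt_hom_ext ?_⟩
    rw [← hy]
    exact congrArg (e.app (⊥_ Gr)) (ofInitial_app_one y)

/-- The functors `X ↦ ℤ[Xⁿ]`. -/
noncomputable def powerFun : ℕ → FunGr.{u}
  | 0 => constInt
  | n + 1 => ind (powerFun n)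

/-- The iterated coproducts of the free group of rank one. -/
noncomputable def freeSum : ℕ → Gr
  | 0 => ⊥_ Gr
  | n + 1 => Z ⨿ freeSum n

/-- The part of Yoneda needed for covering: ℤ[Xⁿ] is represented by the free group of rank n, and y
is the tautological element, built by passing from F to `shift F`. -/
lemma exists_hom_powerFun (n : ℕ) (F : FunGr.{u}) (x : F.obj (freeSum n)) :
    ∃ (f : powerFun n ⟶ F) (y : (powerFun.{u} n).obj (freeSum n)), f.app _ y = x := by
  induction n generalizing F with
  | zero => exact ⟨ofInitial x, _, ofInitial_app_one x⟩
  | succ n ih =>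
    obtain ⟨f, y, hy⟩ := ih (shift F) x
    refine ⟨ofShift f, tmul (gen (freeSum n)) ((powerFun n).map coprod.inr y), ?_⟩
    have h : f.app (Z ⨿ freeSum n) ((powerFun n).map coprod.inr y) =
        F.map (coprod.map (𝟙 Z) coprod.inr) x := by
      rw [naturality_apply, hy]
    have h' (x : F.obj (Z ⨿ freeSum n)) :
        F.map (ins (gen (freeSum n))) (F.map (coprod.map (𝟙 Z) coprod.inr) x) = x := by
      rw [map_comp_apply, map_inr_ins_gen]
      exact map_id_apply F x
    exact (ofShift_tmul f _ _).trans ((congrArg (F.map (ins (gen (freeSum n)))) h).trans (h' x))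

/-- A retract suffices for surjectivity of `coverMap`: x is transported along s, covered there, and
brought back along r. -/
lemma exists_retract_freeSum (n : ℕ) :
    ∃ (s : (⟨n⟩ : Gr) ⟶ freeSum n) (r : freeSum n ⟶ ⟨n⟩), s ≫ r = 𝟙 _ := by
  induction n with
  | zero => exact ⟨0, 0, hom_ext_of fun i => i.elim0⟩
  | succ n ih =>
    obtain ⟨s, r, hsr⟩ := ih
    let σ : (⟨n⟩ : Gr) ⟶ ⟨n + 1⟩ := FreeGroup.map Fin.succ
    let r' : Z ⨿ freeSum n ⟶ ⟨n + 1⟩ := coprod.desc (elt (FreeGroup.of 0)) (r ≫ σ)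
    let s' : (⟨n + 1⟩ : Gr) ⟶ Z ⨿ freeSum n :=
      FreeGroup.lift (β := (Z ⨿ freeSum n).group) (Fin.cases (gen (freeSum n)) fun i =>
        Hom.toMonoidHom (s ≫ coprod.inr) (FreeGroup.of i))
    refine ⟨s', r', hom_ext_of fun i => ?_⟩
    have hs : Hom.toMonoidHom s' (FreeGroup.of i) = Fin.cases (gen (freeSum n)) (fun i =>
        Hom.toMonoidHom (s ≫ coprod.inr) (FreeGroup.of i)) i := FreeGroup.lift_apply_of
    refine (congrArg (Hom.toMonoidHom r') hs).trans ?_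
    induction i using Fin.cases with
    | zero =>
      have : (coprod.inl : Z ⟶ Z ⨿ freeSum n) ≫ r' = elt (FreeGroup.of 0) := coprod.inl_desc _ _
      exact (congrArg (fun f => Hom.toMonoidHom f (FreeGroup.of 0)) this).trans
        (toMonoidHom_elt_of _)
    | succ i =>
      have : (s ≫ coprod.inr) ≫ r' = σ := by
        rw [Category.assoc, coprod.inr_desc, ← Category.assoc, hsr, Category.id_comp]
      exact (congrArg (fun f => Hom.toMonoidHom f (FreeGroup.of i)) this).trans FreeGroup.map.of

variable (F : FunGr.{u})

/-- The index set of the projective cover of a functor. -/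
abbrev CoverIndex : Type u := Σ n, F.obj (freeSum n)

/-- The summands of the projective cover of a functor. -/
noncomputable abbrev coverSummand (j : CoverIndex F) : FunGr.{u} := powerFun j.1

/-- The canonical morphism from a coproduct of the functors `X ↦ ℤ[Xⁿ]`. -/
noncomputable def coverMap : ∐ coverSummand F ⟶ F :=
  Sigma.desc fun j => (exists_hom_powerFun j.1 F j.2).choose

instance : Epi (coverMap F) := by
  rw [NatTrans.epi_iff_epi_app]
  rintro ⟨n⟩
  rw [AddCommGrpCat.epi_iff_surjective]
  intro x
  obtain ⟨s, r, hsr⟩ := exists_retract_freeSum n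
  let j : CoverIndex F := ⟨n, F.map s x⟩
  obtain ⟨y, hy⟩ := (exists_hom_powerFun n F (F.map s x)).choose_spec
  refine ⟨(Sigma.ι (coverSummand F) j).app _ ((powerFun n).map r y), ?_⟩
  have h : Sigma.ι (coverSummand F) j ≫ coverMap F =
      (exists_hom_powerFun n F (F.map s x)).choose := Sigma.ι_desc _ _
  refine (ConcreteCategory.congr_hom (NatTrans.congr_app h ⟨n⟩) ((powerFun n).map r y)).trans ?_
  rw [naturality_apply, hy, map_comp_apply, hsr, map_id_apply]

end Cover

/-! ### The acyclic polynomial cover -/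

section PolynomialCover

open Abelian

variable [HasExt.{w'} FunGr.{u}]

/-- ℤ[-] ⊗ M is an extension of M by I ⊗ M, and I ⊗ - preserves projectives because Δ preserves
epimorphisms. -/
instance (n : ℕ) : Projective (powerFun.{u} n) := by
  induction n with
  | zero => exact inferInstanceAs (Projective constInt)
  | succ n ih =>
    have : Projective (redInd.obj (powerFun n)) := redIndAdjunction.map_projective _ ih
    obtain ⟨_, hS⟩ := shortExact_aug (powerFun.{u} n)
    refine projective_iff_subsingleton_ext_one.2 fun Y => ?_
    exact subsingleton_ext_X₂ hS Y (Ext.subsingleton_of_projective (redInd.obj (powerFun n)) Y 0)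
      (Ext.subsingleton_of_projective (powerFun n) Y 0)

/-- The filtration of `X ↦ ℤ[Xⁿ]` by the powers of the augmentation ideal of `Xⁿ`. -/
noncomputable def powerFiltration : ∀ n, PolyFiltration (powerFun.{u} n)
  | 0 => PolyFiltration.const _
  | n + 1 => (powerFiltration n).induced

variable (d : ℕ) (F : FunGr.{u})

/-- The terms of degree `d + 1` in the summands of the projective cover. -/
noncomputable abbrev coverKernelSummand (j : CoverIndex F) : FunGr.{u} :=
  ((powerFiltration j.1).K (d + 1)).toFunctor

/-- The inclusion of the terms of degree `d + 1` in the projective cover. -/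
noncomputable abbrev coverKernelMap : ∐ coverKernelSummand d F ⟶ ∐ coverSummand F :=
  Limits.Sigma.map fun j => ((powerFiltration j.1).K (d + 1)).ι

/-- The quotient of degree at most `d` of the projective cover. -/
noncomputable abbrev polyCover : FunGr.{u} := cokernel (coverKernelMap d F)

/-- Exactness on the left holds because coproducts in `FunGr` preserve monomorphisms. -/
lemma shortExact_polyCover :
    (ShortComplex.mk (coverKernelMap d F) (cokernel.π (coverKernelMap d F))
      (cokernel.condition _)).ShortExact where
  exact := ShortComplex.exact_cokernel _

lemma orthogonal_coverKernel : Orthogonal (d + 1) (∐ coverKernelSummand d F) :=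
  orthogonal_sigma fun j => (powerFiltration j.1).orthogonal (d + 1)

lemma isPolynomialOfDegreeLE_polyCover : IsPolynomialOfDegreeLE d (polyCover d F) := by
  refine isPolynomialOfDegreeLE_of_iterate_alt (N := d + 1) fun Y e he => ?_
  -- Viewed as a morphism of abelian groups, the iterate can be tested after the epimorphism from
  -- the coproduct, one summand at a time.
  let a : AddMonoid.End ((polyCover d F).obj Y) := alt (polyCover d F) (List.ofFn e)
  let A : AddMonoid.End ((polyCover d F).obj Y) := a ^ (d + 1)
  have hA (x) : A x = (alt (polyCover d F) (List.ofFn e))^[d + 1] x :=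
    congrFun (AddMonoid.End.coe_pow _ a (d + 1)) x
  suffices h : AddCommGrpCat.ofHom A = 0 from
    fun x => (hA x).symm.trans (ConcreteCategory.congr_hom h x)
  rw [← cancel_epi ((cokernel.π (coverKernelMap d F)).app Y), comp_zero]
  refine (isColimitOfPreserves ((evaluation Gr AddCommGrpCat.{u}).obj Y)
    (coproductIsCoproduct (coverSummand F))).hom_ext fun ⟨j⟩ => ?_
  rw [comp_zero]
  ext t
  let q : powerFun j.1 ⟶ polyCover d F :=
    Sigma.ι (coverSummand F) j ≫ cokernel.π (coverKernelMap d F)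
  change A (q.app Y t) = 0
  have hq : ((powerFiltration j.1).K (d + 1)).ι ≫ q = 0 := by
    have h : Sigma.ι (coverKernelSummand d F) j ≫ coverKernelMap d F =
        ((powerFiltration j.1).K (d + 1)).ι ≫ Sigma.ι (coverSummand F) j :=
      Limits.Sigma.ι_map (fun j : CoverIndex F => ((powerFiltration j.1).K (d + 1)).ι) j
    rw [← Category.assoc, ← h, Category.assoc, cokernel.condition, comp_zero]
  -- By naturality the iterate can be taken in the summand, where it lands in the term of index d +
  -- 1, which q kills.
  have hs : Function.Semiconj (q.app Y) (alt (powerFun j.1) (List.ofFn e))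
      (alt (polyCover d F) (List.ofFn e)) := fun t => app_alt q _ t
  rw [hA, ← hs.iterate_right (d + 1) t]
  exact ConcreteCategory.congr_hom (NatTrans.congr_app hq Y)
    (SubFun.of _ _ ((powerFiltration j.1).iterate_alt_mem d he t (d + 1) le_rfl))

lemma subsingleton_ext_polyCover {G : FunGr.{u}} (hG : IsPolynomialOfDegreeLE d G) (n : ℕ) :
    Subsingleton (Ext (polyCover d F) G (n + 1)) :=
  subsingleton_ext_succ_X₃ (shortExact_polyCover d F) G
    (orthogonal_coverKernel d F G (Or.inr ⟨d, d.lt_succ_self, hG⟩) n)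
    (Ext.subsingleton_of_projective (∐ coverSummand F) G n)

lemma exists_epi_polyCover (hF : IsPolynomialOfDegreeLE d F) :
    ∃ p : polyCover d F ⟶ F, Epi p := by
  -- The degree 0 part of orthogonality: there is no nonzero map from the kernel to a functor of
  -- degree at most d.
  have h : coverKernelMap d F ≫ coverMap F = 0 := subsingleton_ext_zero_iff.1
    (orthogonal_coverKernel d F F (Or.inr ⟨d, d.lt_succ_self, hF⟩) 0) _
  have : Epi (cokernel.π (coverKernelMap d F) ≫ cokernel.desc _ (coverMap F) h) := by
    rw [cokernel.π_desc]
    infer_instance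
  exact ⟨cokernel.desc _ (coverMap F) h, epi_of_epi (cokernel.π (coverKernelMap d F)) _⟩

end PolynomialCover

end PolyFun

theorem mainTheorem1 (d : ℕ)
    [HasExt.{w} (PolyFun.PolyGr.{u} d)] [HasExt.{w'} PolyFun.FunGr.{u}]
    (F G : PolyFun.PolyGr.{u} d) (n : ℕ) :
    Function.Bijective ((PolyFun.polyInclusion.{u} d).mapExtAddHom F G n) := by
  refine PolyFun.mapExt_bijective_of_acyclic_cover _ (fun X => ?_) F G n
  obtain ⟨p, hp⟩ := PolyFun.exists_epi_polyCover d X.obj X.property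
  refine ⟨⟨_, PolyFun.isPolynomialOfDegreeLE_polyCover d X.obj⟩, ObjectProperty.homMk p,
    (PolyFun.polyInclusion d).epi_of_epi_map hp, fun Y n => ?_⟩
  exact PolyFun.subsingleton_ext_polyCover d X.obj Y.property n
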